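/- Let $k$ be a natural number. A $k$-clique is a $k$-tree, and adding to a $k$-tree a new vertex that is made adjacent to exactly the vertices of one of its $k$-cliques gives a $k$-tree; there are no other $k$-trees. For a $k$-tree $G$ let $\mathcal T(G)$ be the graph whose nodes are the $(k+1)$-cliques of $G$ and those $k$-cliques of $G$ that are contained in more than one $(k+1)$-clique, a $k$-clique being adjacent to a $(k+1)$-clique if it is contained in it (and no other pairs being adjacent). If $G$ has more than $k$ vertices, then $\mathcal T(G)$ is a tree with a unique centre $R$ (the node of minimum eccentricity); root it at $R$. Given a proper colouring $col$ of the clique $R$ with colours from $\{1,\dots,k+1\}$, colour the nodes of $\mathcal T(G)$ from the root downwards: the root is coloured by $col$; a child $S$ of a $(k+1)$-clique $M$ (so $S\subset M$) inherits the colours of its vertices from $M$; in a child $S$ of a $k$-clique $M$ (so $M\subset S$) the vertices of $M$ keep their colours and the vertex in $S\setminus M$ gets the colour in $\{1,\dots,k+1\}$ that is not used in $M$. **Lemma.** Let $G$ be a $k$-tree with more than $k$ vertices and let $R$ be the centre of $\mathcal T(G)$. 1. For every proper colouring $col$ of $R$ with colours from $\{1,\dots,k+1\}$ there is exactly one colouring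 $c$ of the vertices of $G$ such that every node of $\mathcal T(G)$ receives exactly one colouring by the procedure, namely the restriction of $c$. This $c$ is a proper colouring of $G$ with colours $\{1,\dots,k+1\}$, it extends $col$, and it is the only proper colouring of $G$ with these colours that extends $col$. 2. The colouring is isomorphism invariant: if $\varphi$ is an isomorphism from $G$ to a $k$-tree $H$, and $R'$ is the centre of $\mathcal T(H)$, then $\varphi(R)=R'$; and if $col$, $col'$ are proper colourings of $R$, $R'$ with $col'(\varphi(v))=col(v)$ for all $v\in R$, then the colourings $c$ of $G$ and $c'$ of $H$ defined from them by the procedure satisfy $c'(\varphi(v))=c(v)$ for all vertices $v$ of $G$. 3. For each fixed $k$, the function that maps $(G,col)$ to $c$ is computable in logspace, that is, by a deterministic Turing machine with a read-only input tape, work tapes on which it uses $O(\log N)$ cells on inputs of length $N$, and a write-only output tape. (Here the vertices of $G$ are $0,\dots,n-1$; the input lists, for each vertex, its colour under $col$, or a blank if it is not in $R$, and its row of the adjacency matrix; the output is the list of the colours $c(0),\dots,c(n-1)$.) -/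

import Mathlib

/-! ### `k`-trees -/

namespace KTree

/-- `KTreeOn k G s` says that the subgraph of `G` induced on the vertex set `s` is a `k`-tree:
a `k`-clique is a `k`-tree, and a `k`-tree may be extended by one new vertex `v` that is made
adjacent to exactly the vertices of a `k`-clique `K` of the graph constructed so far. -/
inductive KTreeOn {V : Type*} (k : ℕ) (G : SimpleGraph V) : Finset V → Prop
  | clique (s : Finset V) (hs : G.IsNClique k s) : KTreeOn k G s
  | extend (s K : Finset V) (v : V) (hs : KTreeOn k G s) (hv : v ∉ s) (hKs : K ⊆ s)
      (hK : G.IsNClique k K) (hadj : ∀ u ∈ s, (G.Adj v u ↔ u ∈ K)) :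
      KTreeOn k G (Finset.cons v s hv)

/-- The finite graph `G` is a `k`-tree. -/
def IsKTree {V : Type*} [Fintype V] (k : ℕ) (G : SimpleGraph V) : Prop :=
  KTreeOn k G Finset.univ

/-! ### The tree decomposition of a `k`-tree -/

/-- The cliques that are nodes of the decomposition: all `(k+1)`-cliques, and those `k`-cliques
that are contained in more than one `(k+1)`-clique. -/
def IsNode {V : Type*} (k : ℕ) (G : SimpleGraph V) (M : Finset V) : Prop :=
  G.IsNClique (k + 1) M ∨
    (G.IsNClique k M ∧ ∃ A B : Finset V, A ≠ B ∧
      G.IsNClique (k + 1) A ∧ G.IsNClique (k + 1) B ∧ M ⊆ A ∧ M ⊆ B)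

/-- The type of nodes of the decomposition. -/
abbrev Node {V : Type*} (k : ℕ) (G : SimpleGraph V) : Type _ :=
  {M : Finset V // IsNode k G M}

/-- The decomposition tree: a `k`-clique and a `(k+1)`-clique are adjacent if the former is
contained in the latter, and there are no other adjacencies. -/
def decompTree {V : Type*} (k : ℕ) (G : SimpleGraph V) : SimpleGraph (Node k G) where
  Adj M N :=
    (M.1.card = k ∧ N.1.card = k + 1 ∧ M.1 ⊆ N.1) ∨
      (N.1.card = k ∧ M.1.card = k + 1 ∧ N.1 ⊆ M.1)
  symm := ⟨fun _ _ h => h.symm⟩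
  loopless := ⟨fun _ h => by omega⟩

/-- In the decomposition tree rooted at `R`, the node `S` is a child of the node `M`: they are
adjacent, and `M` lies on the path from `S` to the root. -/
def IsChild {V : Type*} {k : ℕ} {G : SimpleGraph V} (R M S : Node k G) : Prop :=
  (decompTree k G).Adj M S ∧ ∃ p : (decompTree k G).Walk S R, p.IsPath ∧ M ∈ p.support

/-! ### The colouring procedure -/

/-- The subgraph of `G` induced on the clique `M`. -/
abbrev cliqueGraph {V : Type*} {k : ℕ} (G : SimpleGraph V) (M : Node k G) :
    SimpleGraph {v // v ∈ M.1} :=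
  G.comap Subtype.val

/-- `NodeColouring R col M f`: the top-down procedure on the decomposition tree rooted at `R`,
started with the colouring `col` of the vertices in `R`, colours the vertices in the node `M`
according to `f`. -/
inductive NodeColouring {V : Type*} {k : ℕ} {G : SimpleGraph V} (R : Node k G)
    (col : {v // v ∈ R.1} → Fin (k + 1)) :
    (M : Node k G) → ({v // v ∈ M.1} → Fin (k + 1)) → Prop
  /-- The root keeps its given colouring. -/
  | root : NodeColouring R col R col
  /-- A child of a `(k+1)`-clique is a `k`-clique contained in it and inherits its colours. -/
  | shrink (M S : Node k G) (f : {v // v ∈ M.1} → Fin (k + 1))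
      (hf : NodeColouring R col M f) (hM : M.1.card = k + 1) (hMS : IsChild R M S)
      (hsub : S.1 ⊆ M.1) :
      NodeColouring R col S (fun v => f ⟨v.1, hsub v.2⟩)
  /-- A child of a `k`-clique `M` is a `(k+1)`-clique `S` containing it: the vertices of `M` keep
  their colours, and the vertex in `S \ M` gets a colour that is not used in `M`. -/
  | grow (M S : Node k G) (f : {v // v ∈ M.1} → Fin (k + 1))
      (g : {v // v ∈ S.1} → Fin (k + 1))
      (hf : NodeColouring R col M f) (hM : M.1.card = k) (hMS : IsChild R M S)
      (hsub : M.1 ⊆ S.1)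
      (hold : ∀ u : {v // v ∈ M.1}, g ⟨u.1, hsub u.2⟩ = f u)
      (hnew : ∀ w : {v // v ∈ S.1}, w.1 ∉ M.1 → ∀ u : {v // v ∈ M.1}, g w ≠ f u) :
      NodeColouring R col S g

/-- `c` is the vertex colouring of `G` defined by the procedure: every node of the decomposition
tree receives exactly one colouring of its vertices, namely the restriction of `c`. -/
def IsProcedureColouring {V : Type*} {k : ℕ} {G : SimpleGraph V} (R : Node k G)
    (col : {v // v ∈ R.1} → Fin (k + 1)) (c : V → Fin (k + 1)) : Prop :=
  ∀ (M : Node k G) (f : {v // v ∈ M.1} → Fin (k + 1)),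
    NodeColouring R col M f ↔ f = fun v => c v.1

/-! ### Logspace computability -/

/-- What the head of the input tape can see: an end marker or a symbol of the input word. -/
inductive InputSymbol (α : Type)
  | leftEnd : InputSymbol α
  | sym (a : α) : InputSymbol α
  | rightEnd : InputSymbol α

/-- Head moves. -/
inductive Move
  | left
  | stay
  | right

/-- A deterministic Turing machine with a two-way read-only input tape over `α`, finitely many
read-write work tapes, and a one-way write-only output tape over `β`. In each step the transition
function sees the state, the scanned input symbol and the scanned work symbols; it either halts
(`none`), or gives the new state, the move of the input head, for every work tape the symbol to
write and the move of its head, and the symbol (if any) to append to the output. -/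
structure Transducer (α β : Type) where
  /-- States. -/
  State : Type
  finState : Finite State
  /-- The initial state. -/
  start : State
  /-- The work alphabet. -/
  Work : Type
  finWork : Finite Work
  /-- The blank symbol of the work tapes. -/
  blank : Work
  /-- The index set of the work tapes. -/
  Tape : Type
  finTape : Finite Tape
  /-- The transition function. -/
  trans : State → InputSymbol α → (Tape → Work) →
    Option (State × Move × (Tape → Work × Move) × Option β)

/-- Configurations. Work tapes are infinite to the right. -/
structure Transducer.Cfg {α β : Type} (T : Transducer α β) where
  /-- The current state. -/
  state : T.State
  /-- The position of the input head. -/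
  inputHead : ℕ
  /-- The contents of the work tapes. -/
  work : T.Tape → ℕ → T.Work
  /-- The positions of the heads on the work tapes. -/
  workHead : T.Tape → ℕ
  /-- The output written so far. -/
  output : List β

/-- Cell `0` of the input tape holds the left end marker, cells `1, …, |x|` the input word `x`,
and cell `|x| + 1` the right end marker. -/
def readInput {α : Type} (x : List α) (p : ℕ) : InputSymbol α :=
  if p = 0 then .leftEnd
  else match x[p - 1]? with
    | some a => .sym a
    | none => .rightEnd

/-- Moving a head on a one-way infinite tape; at cell `0` a move to the left has no effect. -/
def Move.apply : Move → ℕ → ℕ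
  | .left, p => p - 1
  | .stay, p => p
  | .right, p => p + 1

/-- The initial configuration. -/
def Transducer.init {α β : Type} (T : Transducer α β) : T.Cfg where
  state := T.start
  inputHead := 0
  work := fun _ _ => T.blank
  workHead := fun _ => 0
  output := []

/-- One step on the input word `x`. The input head cannot leave the cells `0, …, |x| + 1`. -/
def Transducer.step {α β : Type} (T : Transducer α β) (x : List α) (c : T.Cfg) : Option T.Cfg :=
  (T.trans c.state (readInput x c.inputHead) (fun i => c.work i (c.workHead i))).map
    fun (q, m, w, o) =>
      { state := q
        inputHead := min (m.apply c.inputHead) (x.length + 1)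
        work := fun i => Function.update (c.work i) (c.workHead i) (w i).1
        workHead := fun i => (w i).2.apply (c.workHead i)
        output := c.output ++ o.toList }

/-- The (total) function `f` on words is computable in logarithmic space: some machine halts on
every input word `x` with output `f x`, and on input `x` its work heads visit only the first
`O(log |x|)` cells of the work tapes. -/
def LogspaceComputable {α β : Type} (f : List α → List β) : Prop :=
  ∃ T : Transducer α β,
    (∀ x : List α, ∃ c ∈ StateTransition.eval (T.step x) T.init, c.output = f x) ∧
    ∃ C : ℕ, ∀ (x : List α) (c : T.Cfg), StateTransition.Reaches (T.step x) T.init c →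
      ∀ i, c.workHead i ≤ C * (Nat.log 2 x.length + 1)

/-! ### Encoding of the input -/

/-- The input word for a graph `G` on the vertices `0, …, n-1` with a colouring `col` of the
vertices in `R`: for each vertex `v` in turn, the colour of `v` (or `none` if `v ∉ R`),
followed by the row of `v` in the adjacency matrix. -/
def encodeInput {k n : ℕ} (G : SimpleGraph (Fin n)) [DecidableRel G.Adj] (R : Finset (Fin n))
    (col : {v // v ∈ R} → Fin (k + 1)) : List (Bool ⊕ Option (Fin (k + 1))) :=
  (List.finRange n).flatMap fun v =>
    Sum.inr (if h : v ∈ R then some (col ⟨v, h⟩) else none) ::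
      (List.finRange n).map fun w => Sum.inl (decide (G.Adj v w))

end KTree

namespace KTree

/-! ### Cliques of `k`-trees -/

section Graph

open scoped Classical

variable {V : Type*} {k : ℕ} {G : SimpleGraph V}

/-! The tree. Statements on cliques are proved by induction along the construction of the `k`-tree.
The vertex `v` added last, attached to `K`, lies in only one `(k+1)`-clique, namely `insert v K`.
This clique is joined to the older ones through `K`, which gives connectedness
(`KTreeOn.reachable`), and it cannot lie on a cycle (`KTreeOn.not_isCycle`). A `k`-clique is a node
only if it has two neighbours, so all leaves are `(k+1)`-cliques. Two centres would be adjacent, and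
their equal eccentricities would be attained at nodes of the same class of the bipartition, which
parity forbids.

The colouring. The procedure is compared with proper colourings of `G`. A greedy colouring exists,
and a permutation of the colours makes it agree with `col` on the clique `R`. Any proper extension
of `col` gives each node the colouring that the procedure gives it, because a `k`-clique leaves only
one colour free (`NodeColouring.eq_coloring`, `NodeColouring.of_path`). So the colouring of the
procedure is the only proper extension, and invariance follows by pulling a colouring back along the
isomorphism.

Logarithmic space. The machine walks around the decomposition tree and remembers only `k+1` vertex
numbers and an index. The slots of the tuple are the colours: a vertex that completes a `k`-clique
has the colour of the slot it fills. On a `k`-clique the tour tries the candidates for the open slot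
in cyclic order, on a `(k+1)`-clique it goes on with the next slot (`tourStep`). The orbit of the
start is eventually periodic. On a periodic orbit, a tour that leaves a `(k+1)`-clique through one
of its `k`-subsets has to come back through it, because of a bridge in the tree (`exists_side`,
`Visits.succ_index`). Hence all slots of a visited clique are tried, then all cliques that differ in
one vertex are visited, and by connectedness all cliques (`visits_rainbow_of_periodic`). Each state
on the tour occurs before the number of states is used up, so `k+2` nested loops over the vertex
numbers run long enough (`search_eq_some`). The program is put together from fragments that work on
binary counters. -/

theorem clique_subset_of_mem {s K A : Finset V} {v : V} {hv : v ∉ s}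
    (hadj : ∀ u ∈ s, (G.Adj v u ↔ u ∈ K)) {m : ℕ} (hA : G.IsNClique m A)
    (hAs : A ⊆ Finset.cons v s hv) (hvA : v ∈ A) : A ⊆ insert v K := by
  intro u hu
  by_cases huv : u = v
  · simp [huv]
  · have hus : u ∈ s := by
      have := hAs hu
      simp only [Finset.mem_cons] at this
      tauto
    exact Finset.mem_insert_of_mem ((hadj u hus).1 (hA.1 hvA hu (Ne.symm huv)))

theorem clique_eq_insert_of_mem {s K A : Finset V} {v : V} {hv : v ∉ s} (hK : G.IsNClique k K)
    (hadj : ∀ u ∈ s, (G.Adj v u ↔ u ∈ K)) (hA : G.IsNClique (k + 1) A)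
    (hAs : A ⊆ Finset.cons v s hv) (hvA : v ∈ A) : A = insert v K := by
  refine Finset.eq_of_subset_of_card_le (clique_subset_of_mem hadj hA hAs hvA) ?_
  rw [hA.2, ← hK.2]
  exact Finset.card_insert_le _ _

theorem isNClique_insert {s K : Finset V} {v : V} (hKs : K ⊆ s) (hK : G.IsNClique k K)
    (hadj : ∀ u ∈ s, (G.Adj v u ↔ u ∈ K)) : G.IsNClique (k + 1) (insert v K) :=
  hK.insert fun u hu => (hadj u (hKs hu)).2 hu

theorem subset_of_not_mem_cons {s A : Finset V} {v : V} {hv : v ∉ s}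
    (hAs : A ⊆ Finset.cons v s hv) (hvA : v ∉ A) : A ⊆ s := by
  intro u hu
  have := hAs hu
  simp only [Finset.mem_cons] at this
  rcases this with rfl | h
  · exact absurd hu hvA
  · exact h

theorem KTreeOn.le_card {s : Finset V} (h : KTreeOn k G s) : k ≤ s.card := by
  induction h with
  | clique s hs => exact hs.2.ge
  | extend s K v hs hv hKs hK hadj ih => rw [Finset.card_cons]; omega

/-- This supplies the old `(k+1)`-clique on which a new one is hung. A clique through the newest
vertex lies in `insert v K`. An old one is covered by induction, unless the old part is a single
`k`-clique, which is then `K` itself. -/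
theorem KTreeOn.exists_succ_clique {s : Finset V} (h : KTreeOn k G s) (hk : k < s.card)
    {L : Finset V} (hL : L ⊆ s) (hLc : G.IsNClique k L) :
    ∃ A ⊆ s, L ⊆ A ∧ G.IsNClique (k + 1) A := by
  induction h with
  | clique s hs => exact absurd hs.2 hk.ne'
  | extend s K v hs hv hKs hK hadj ih =>
    have hins : insert v K ⊆ Finset.cons v s hv := by
      rw [Finset.cons_eq_insert]; exact Finset.insert_subset_insert _ hKs
    by_cases hvL : v ∈ L
    · exact ⟨insert v K, hins, clique_subset_of_mem hadj hLc hL hvL,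
        isNClique_insert hKs hK hadj⟩
    · have hLs := subset_of_not_mem_cons hL hvL
      by_cases hks : k < s.card
      · obtain ⟨A, hA, h1, h2⟩ := ih hks hLs
        exact ⟨A, hA.trans (Finset.subset_cons hv), h1, h2⟩
      · have hcard : s.card = k := le_antisymm (not_lt.1 hks) hs.le_card
        have h1 : L = s := Finset.eq_of_subset_of_card_le hLs (by rw [hLc.2, hcard])
        have h2 : K = s := Finset.eq_of_subset_of_card_le hKs (by rw [hK.2, hcard])
        refine ⟨insert v K, hins, ?_, isNClique_insert hKs hK hadj⟩
        rw [h1, ← h2]; exact Finset.subset_insert _ _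

theorem KTreeOn.exists_clique {s : Finset V} (h : KTreeOn k G s) :
    ∃ L ⊆ s, G.IsNClique k L := by
  cases h with
  | clique s hs => exact ⟨s, subset_rfl, hs⟩
  | extend s K v hs hv hKs hK hadj => exact ⟨K, hKs.trans (Finset.subset_cons hv), hK⟩

theorem KTreeOn.exists_mem_clique {s : Finset V} (h : KTreeOn k G s) (hk : k < s.card)
    {v : V} (hv : v ∈ s) : ∃ A ⊆ s, v ∈ A ∧ G.IsNClique (k + 1) A := by
  -- The initial clique violates `k < s.card`, so the induction is run on a disjunction that does
  -- without it.
  have key : (∃ L ⊆ s, v ∈ L ∧ G.IsNClique k L) ∨ ∃ A ⊆ s, v ∈ A ∧ G.IsNClique (k + 1) A := by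
    clear hk
    induction h with
    | clique s hs => exact .inl ⟨s, subset_rfl, hv, hs⟩
    | extend s K w hs hw hKs hK hadj ih =>
      rcases Finset.mem_cons.1 hv with rfl | hvs
      · refine .inr ⟨insert v K, ?_, Finset.mem_insert_self _ _, isNClique_insert hKs hK hadj⟩
        rw [Finset.cons_eq_insert]; exact Finset.insert_subset_insert _ hKs
      · rcases ih hvs with ⟨L, h1, h2⟩ | ⟨A, h1, h2⟩
        · exact .inl ⟨L, h1.trans (Finset.subset_cons hw), h2⟩
        · exact .inr ⟨A, h1.trans (Finset.subset_cons hw), h2⟩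
  rcases key with ⟨L, h1, h2, h3⟩ | h
  · obtain ⟨A, hA, hLA, h4⟩ := h.exists_succ_clique hk h1 h3
    exact ⟨A, hA, hLA h2, h4⟩
  · exact h

/-! ### Colourability -/

theorem exists_color_not_mem_image {K : Finset V} (hK : K.card = k) (c : V → Fin (k + 1)) :
    ∃ i, ∀ u ∈ K, i ≠ c u := by
  have : (K.image c).card < (Finset.univ : Finset (Fin (k + 1))).card := by
    rw [Finset.card_univ, Fintype.card_fin]
    exact Finset.card_image_le.trans_lt (by omega)
  obtain ⟨i, -, hi⟩ := Finset.exists_mem_notMem_of_card_lt_card this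
  exact ⟨i, fun u hu h => hi (Finset.mem_image.2 ⟨u, hu, h.symm⟩)⟩

/-- Greedy colouring: a new vertex has only `k` neighbours among the old ones. -/
theorem KTreeOn.exists_coloring {s : Finset V} (h : KTreeOn k G s) :
    ∃ c : V → Fin (k + 1), ∀ u ∈ s, ∀ v ∈ s, G.Adj u v → c u ≠ c v := by
  induction h with
  | clique s hs =>
    have : s.card ≤ Fintype.card (Fin (k + 1)) := by rw [hs.2, Fintype.card_fin]; omega
    obtain ⟨f⟩ : Nonempty (s ↪ Fin (k + 1)) :=
      Function.Embedding.nonempty_of_card_le (by simpa using this)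
    refine ⟨fun v => if h : v ∈ s then f ⟨v, h⟩ else 0, fun u hu v hv huv heq => ?_⟩
    simp only [hu, hv, dif_pos] at heq
    exact huv.ne (congrArg Subtype.val (f.injective heq))
  | extend s K v hs hv hKs hK hadj ih =>
    obtain ⟨c, hc⟩ := ih
    obtain ⟨i, hi⟩ := exists_color_not_mem_image hK.2 c
    refine ⟨Function.update c v i, fun u hu w hw huw => ?_⟩
    rcases Finset.mem_cons.1 hu with rfl | hu' <;> rcases Finset.mem_cons.1 hw with rfl | hw'
    · exact absurd rfl huw.ne
    · rw [Function.update_self, Function.update_of_ne huw.ne']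
      exact hi w ((hadj w hw').1 huw)
    · rw [Function.update_self, Function.update_of_ne huw.ne]
      exact (hi u ((hadj u hu').1 huw.symm)).symm
    · rw [Function.update_of_ne (ne_of_mem_of_not_mem hu' hv),
        Function.update_of_ne (ne_of_mem_of_not_mem hw' hv)]
      exact hc u hu' w hw' huw

theorem coloring_injOn (C : G.Coloring (Fin (k + 1))) {m : ℕ} {M : Finset V}
    (hM : G.IsNClique m M) : Set.InjOn C M := by
  intro u hu v hv h
  by_contra huv
  exact C.valid (hM.1 hu hv huv) h

/-- In a proper colouring, the colour of a vertex outside a `k`-clique that differs from all colours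
of the clique is unique. -/
theorem color_unique (C : G.Coloring (Fin (k + 1))) {M : Finset V} (hM : G.IsNClique k M)
    {i j : Fin (k + 1)} (hi : ∀ u ∈ M, i ≠ C u) (hj : ∀ u ∈ M, j ≠ C u) : i = j := by
  by_contra hij
  have hsub : insert i (insert j (M.image C)) ⊆ Finset.univ := Finset.subset_univ _
  have h1 := Finset.card_le_card hsub
  rw [Finset.card_insert_of_notMem, Finset.card_insert_of_notMem, Finset.card_image_of_injOn
    (coloring_injOn C hM), hM.2, Finset.card_univ, Fintype.card_fin] at h1
  · omega
  · rintro h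
    obtain ⟨u, hu, rfl⟩ := Finset.mem_image.1 h
    exact hj u hu rfl
  · rintro h
    rcases Finset.mem_insert.1 h with h | h
    · exact hij h
    · obtain ⟨u, hu, rfl⟩ := Finset.mem_image.1 h
      exact hi u hu rfl

/-! ### The decomposition tree -/

theorem IsNode.isClique {M : Finset V} (h : IsNode k G M) : G.IsClique (M : Set V) := by
  rcases h with h | h
  · exact h.1
  · exact h.1.1

theorem IsNode.card {M : Finset V} (h : IsNode k G M) : M.card = k ∨ M.card = k + 1 := by
  rcases h with h | h
  · exact .inr h.2
  · exact .inl h.1.2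

theorem Node.isNClique (M : Node k G) : G.IsNClique M.1.card M.1 := ⟨M.2.isClique, rfl⟩

theorem Node.isNClique_of_card {M : Node k G} {m : ℕ} (h : M.1.card = m) : G.IsNClique m M.1 :=
  ⟨M.2.isClique, h⟩

theorem Node.exists_ne_of_card {M : Node k G} (h : M.1.card = k) :
    ∃ A B : Node k G, A ≠ B ∧ (decompTree k G).Adj M A ∧ (decompTree k G).Adj M B := by
  rcases M.2 with h' | ⟨-, A, B, hAB, hA, hB, h1, h2⟩
  · have := h'.2; omega
  · exact ⟨⟨A, .inl hA⟩, ⟨B, .inl hB⟩, fun h => hAB (congrArg Subtype.val h),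
      .inl ⟨h, hA.2, h1⟩, .inl ⟨h, hB.2, h2⟩⟩

theorem decompTree_adj_of_card {M N : Node k G} (h : (decompTree k G).Adj M N)
    (hM : M.1.card = k) : N.1.card = k + 1 ∧ M.1 ⊆ N.1 := by
  rcases h with h | h
  · exact h.2
  · omega

theorem decompTree_adj_of_card_succ {M N : Node k G} (h : (decompTree k G).Adj M N)
    (hM : M.1.card = k + 1) : N.1.card = k ∧ N.1 ⊆ M.1 := by
  rcases h with h | h
  · omega
  · exact ⟨h.1, h.2.2⟩

/-- Whether a `k`-clique is a node depends on the cliques of all of `G` and not only on those inside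
`s`, so the induction treats `(k+1)`-cliques alone. The new one is joined to an old one through `K`,
which thereby lies in two of them. -/
theorem KTreeOn.reachable {s : Finset V} (h : KTreeOn k G s) {M N : Node k G}
    (hM : M.1.card = k + 1) (hN : N.1.card = k + 1) (hMs : M.1 ⊆ s) (hNs : N.1 ⊆ s) :
    (decompTree k G).Reachable M N := by
  induction h generalizing M N with
  | clique s hs =>
    have := Finset.card_le_card hMs
    rw [hM, hs.2] at this; omega
  | extend s K v hs hv hKs hK hadj ih =>
    have hv' : v ∉ K := fun h => hv (hKs h)
    have hE := isNClique_insert hKs hK hadj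
    have key : ∀ M N : Node k G, M.1.card = k + 1 → N.1.card = k + 1 →
        M.1 ⊆ Finset.cons v s hv → N.1 ⊆ Finset.cons v s hv → v ∈ M.1 → v ∉ N.1 →
        (decompTree k G).Reachable M N := by
      intro M N hM hN hMs hNs hvM hvN
      have hMeq := clique_eq_insert_of_mem hK hadj (Node.isNClique_of_card hM) hMs hvM
      have hNs' := subset_of_not_mem_cons hNs hvN
      have hks : k < s.card := by have := Finset.card_le_card hNs'; omega
      obtain ⟨A, hAs, hKA, hA⟩ := hs.exists_succ_clique hks hKs hK
      have hne : M.1 ≠ A := by rintro h; rw [h] at hvM; exact hv (hAs hvM)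
      let A' : Node k G := ⟨A, .inl hA⟩
      let K' : Node k G := ⟨K, .inr ⟨hK, M.1, A, hne, Node.isNClique_of_card hM, hA,
        by rw [hMeq]; exact Finset.subset_insert _ _, hKA⟩⟩
      have h1 : (decompTree k G).Adj M K' :=
        .inr ⟨hK.2, hM, by rw [hMeq]; exact Finset.subset_insert _ _⟩
      have h2 : (decompTree k G).Adj K' A' := .inl ⟨hK.2, hA.2, hKA⟩
      exact h1.reachable.trans (h2.reachable.trans (ih hA.2 hN hAs hNs'))
    by_cases hvM : v ∈ M.1 <;> by_cases hvN : v ∈ N.1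
    · have h1 := clique_eq_insert_of_mem hK hadj (Node.isNClique_of_card hM) hMs hvM
      have h2 := clique_eq_insert_of_mem hK hadj (Node.isNClique_of_card hN) hNs hvN
      rw [Subtype.ext (h1.trans h2.symm)]
    · exact key M N hM hN hMs hNs hvM hvN
    · exact (key N M hN hM hNs hMs hvN hvM).symm
    · exact ih hM hN (subset_of_not_mem_cons hMs hvM) (subset_of_not_mem_cons hNs hvN)

/-- A `k`-clique through the newest vertex has at most one neighbour inside the current vertex set,
and `insert v K` has only the neighbour `K` that avoids `v`; neither fits on a cycle. In the initial
clique all nodes have size `k`, whereas adjacent nodes differ in size. -/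
theorem KTreeOn.not_isCycle {s : Finset V} (h : KTreeOn k G s) {M : Node k G}
    (p : (decompTree k G).Walk M M) (hp : ∀ N ∈ p.support, N.1 ⊆ s) : ¬ p.IsCycle := by
  induction h generalizing M with
  | clique s hs =>
    intro hc
    have h1 := p.adj_snd hc.not_nil
    have h2 : ∀ N ∈ p.support, N.1.card = k := by
      intro N hN
      have := Finset.card_le_card (hp N hN)
      rw [hs.2] at this
      rcases N.2.card with h | h <;> omega
    have h3 := h2 M p.start_mem_support
    have h4 := h2 _ (p.snd_mem_support_of_mem_edges (by exact p.mk_start_snd_mem_edges hc.not_nil))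
    have := decompTree_adj_of_card h1 h3
    omega
  | extend s K v hs hv hKs hK hadj ih =>
    intro hc
    -- no `k`-clique on the cycle contains the new vertex
    have key : ∀ N : Node k G, N.1.card = k → v ∈ N.1 → ∀ q : (decompTree k G).Walk N N,
        q.IsCycle → ¬ ∀ N ∈ q.support, N.1 ⊆ Finset.cons v s hv := by
      intro N hN hvN q hq hqs
      have hn := hq.not_nil
      have h1 := decompTree_adj_of_card (q.adj_snd hn) hN
      have h2 := decompTree_adj_of_card (q.adj_penultimate hn).symm hN
      refine hq.snd_ne_penultimate (Subtype.ext ?_)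
      rw [clique_eq_insert_of_mem hK hadj (Node.isNClique_of_card h1.1)
          (hqs _ (q.getVert_mem_support _)) (h1.2 hvN),
        clique_eq_insert_of_mem hK hadj (Node.isNClique_of_card h2.1)
          (hqs _ (q.getVert_mem_support _)) (h2.2 hvN)]
    have rot : ∀ N : Node k G, N ∈ p.support → N.1.card = k → v ∉ N.1 := by
      intro N hN hNk hvN
      refine key N hNk hvN (p.rotate N hN) (hc.rotate hN) fun A hA => hp A ?_
      exact (p.mem_support_rotate_iff N hN).1 hA
    by_cases hall : ∀ N ∈ p.support, N.1 ⊆ s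
    · exact ih p hall hc
    · push Not at hall
      obtain ⟨N, hN, hNs⟩ := hall
      have hvN : v ∈ N.1 := by
        by_contra hvN
        exact hNs (subset_of_not_mem_cons (hp N hN) hvN)
      have hNk : N.1.card = k + 1 := by
        rcases N.2.card with h | h
        · exact absurd hvN (rot N hN h)
        · exact h
      have hNeq := clique_eq_insert_of_mem hK hadj (Node.isNClique_of_card hNk) (hp N hN) hvN
      let q := p.rotate N hN
      have hq : q.IsCycle := hc.rotate hN
      have hqp : ∀ A ∈ q.support, A ∈ p.support := fun A hA =>
        (p.mem_support_rotate_iff N hN).1 hA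
      have hn := hq.not_nil
      -- A `k`-subset of `insert v K` that avoids `v` is `K`, so the two neighbours of `N` on the
      -- cycle coincide.
      have hKeq : ∀ A ∈ q.support, (decompTree k G).Adj N A → A.1 = K := by
        intro A hA hNA
        obtain ⟨h1, h2⟩ := decompTree_adj_of_card_succ hNA hNk
        have h3 := rot A (hqp A hA) h1
        refine Finset.eq_of_subset_of_card_le (fun u hu => ?_) (by rw [h1, hK.2])
        have := h2 hu
        rw [hNeq, Finset.mem_insert] at this
        rcases this with rfl | h
        · exact absurd hu h3
        · exact h
      exact hq.snd_ne_penultimate (Subtype.ext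
        ((hKeq _ (q.getVert_mem_support _) (q.adj_snd hn)).trans
          (hKeq _ (q.getVert_mem_support _) (q.adj_penultimate hn).symm).symm))

variable [Fintype V]

theorem IsKTree.exists_mem_node (h : IsKTree k G) (hk : k < Fintype.card V) (v : V) :
    ∃ M : Node k G, M.1.card = k + 1 ∧ v ∈ M.1 := by
  obtain ⟨A, -, h1, h2⟩ := KTreeOn.exists_mem_clique h (by simpa using hk) (Finset.mem_univ v)
  exact ⟨⟨A, .inl h2⟩, h2.2, h1⟩

theorem IsKTree.exists_node (h : IsKTree k G) (hk : k < Fintype.card V) :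
    ∃ M : Node k G, M.1.card = k + 1 := by
  obtain ⟨L, hL, hLc⟩ := KTreeOn.exists_clique h
  obtain ⟨A, -, -, h2⟩ := KTreeOn.exists_succ_clique h (by simpa using hk) hL hLc
  exact ⟨⟨A, .inl h2⟩, h2.2⟩

theorem IsKTree.isTree (h : IsKTree k G) (hk : k < Fintype.card V) : (decompTree k G).IsTree := by
  obtain ⟨M₀, hM₀⟩ := h.exists_node hk
  have hr : ∀ M : Node k G, (decompTree k G).Reachable M M₀ := by
    intro M
    rcases M.2.card with hM | hM
    · obtain ⟨A, B, -, hA, -⟩ := Node.exists_ne_of_card hM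
      exact hA.reachable.trans (KTreeOn.reachable h (decompTree_adj_of_card hA hM).1 hM₀
        (Finset.subset_univ _) (Finset.subset_univ _))
    · exact KTreeOn.reachable h hM hM₀ (Finset.subset_univ _) (Finset.subset_univ _)
  have : Nonempty (Node k G) := ⟨M₀⟩
  exact ⟨⟨fun M N => (hr M).trans (hr N).symm⟩,
    fun M p => KTreeOn.not_isCycle h p fun N _ => Finset.subset_univ _⟩

theorem IsKTree.lt_card_of_node (_h : IsKTree k G) (M : Node k G) : k < Fintype.card V := by
  have : ∃ A : Finset V, A.card = k + 1 := by
    rcases M.2.card with hM | hM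
    · obtain ⟨A, B, -, hA, -⟩ := Node.exists_ne_of_card hM
      exact ⟨A.1, (decompTree_adj_of_card hA hM).1⟩
    · exact ⟨M.1, hM⟩
  obtain ⟨A, hA⟩ := this
  have := Finset.card_le_univ A
  omega

end Graph

end KTree

namespace KTree

/-! ### The centre of a tree -/

section Center

variable {α : Type*} {T : SimpleGraph α}

/-- A closer neighbour lies on the path from `y` to `x`: otherwise appending it to this path gives a
path to it that is longer than its distance from `y`, although paths in a tree are unique. On the
path it is the penultimate node. -/
theorem closer_neighbor_unique (hT : T.IsTree) {y x a b : α} (ha : T.Adj x a) (hb : T.Adj x b)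
    (hay : T.dist y a < T.dist y x) (hby : T.dist y b < T.dist y x) : a = b := by
  obtain ⟨p, hp, hlen⟩ := (hT.connected y x).exists_path_of_dist
  have key : ∀ c, T.Adj x c → T.dist y c < T.dist y x → c ∈ p.support := by
    intro c hc hcy
    by_contra hcp
    obtain ⟨q, hq, hqlen⟩ := (hT.connected y c).exists_path_of_dist
    have h := hT.isAcyclic.subsingleton_path y c |>.elim ⟨_, hp.concat hcp hc⟩ ⟨q, hq⟩
    have h2 := congrArg (fun z : T.Path y c => z.1.length) h
    simp only [SimpleGraph.Walk.length_concat] at h2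
    omega
  rw [hT.isAcyclic.eq_penultimate_of_adj_end hp ha (key a ha hay),
    hT.isAcyclic.eq_penultimate_of_adj_end hp hb (key b hb hby)]

/-- A path that has begun to move away from `y` never turns: at a turn, a node would have two
neighbours closer to `y`. -/
theorem dist_eq_add_length (hT : T.IsTree) {y u z w : α} (p : T.Walk z w) (hp : p.IsPath)
    (hu : u ∉ p.support) (huz : T.Adj u z) (h : T.dist y z = T.dist y u + 1) :
    T.dist y w = T.dist y z + p.length := by
  induction p generalizing u with
  | nil => simp
  | @cons z z' w hzz' p ih =>
    rw [SimpleGraph.Walk.cons_isPath_iff] at hp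
    rw [SimpleGraph.Walk.support_cons, List.mem_cons, not_or] at hu
    have h' : T.dist y z' = T.dist y z + 1 := by
      rcases hT.dist_eq_dist_add_one_of_adj y hzz' with h1 | h1
      · refine absurd ?_ (ne_of_mem_of_not_mem p.start_mem_support hu.2)
        exact closer_neighbor_unique hT (y := y) hzz' huz.symm (by omega) (by omega)
      · exact h1
    rw [ih hp.1 hp.2 hzz' h', h', SimpleGraph.Walk.length_cons]
    omega

/-- A finite tree in which all leaves lie in the same class of the bipartition has a unique
centre. -/
theorem exists_center_eq_singleton [Finite α] (hT : T.IsTree) (side : T.Coloring Bool)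
    (hdeg : ∀ y, side y = false → ∃ a b, a ≠ b ∧ T.Adj y a ∧ T.Adj y b) :
    ∃ R, T.center = {R} := by
  have := hT.connected.nonempty
  obtain ⟨u, hu⟩ := T.center_nonempty
  refine ⟨u, Set.eq_singleton_iff_unique_mem.2 ⟨hu, fun w hw => ?_⟩⟩
  by_contra hne
  have hedist : ∀ x y, T.edist x y = (T.dist x y : ℕ∞) := fun x y =>
    ((hT.connected x y).coe_dist_eq_edist).symm
  -- With `y` farthest from `z`, the right side is the eccentricity of `z`, hence at least the
  -- radius.
  have far : ∀ z, ∃ y, ∀ v ∈ T.center, ∀ x, T.dist v x ≤ T.dist z y := by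
    intro z
    obtain ⟨y, hy⟩ := T.exists_edist_eq_eccent_of_finite z
    refine ⟨y, fun v hv x => ?_⟩
    have h1 : T.edist v x ≤ T.edist z y := by
      rw [hy]
      exact (SimpleGraph.edist_le_eccent.trans hv.le).trans SimpleGraph.radius_le_eccent
    rw [hedist, hedist] at h1
    exact_mod_cast h1
  -- Let `z` follow `u` on the path to `w`, and let `y` be farthest from `z`. The step from `u` to
  -- `z` moves away from `y`, and so does the rest of the path; as `w` is not farther from `y` than
  -- `z`, this rest is empty.
  have hadj : T.Adj u w := by
    obtain ⟨p, hp⟩ := (hT.connected u w).exists_isPath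
    cases p with
    | nil => exact absurd rfl hne
    | @cons _ z _ huz p =>
      rw [SimpleGraph.Walk.cons_isPath_iff] at hp
      obtain ⟨y, hy⟩ := far z
      have h1 := hy u hu y
      have h2 := hy w hw y
      rw [SimpleGraph.dist_comm, SimpleGraph.dist_comm (u := z)] at h1 h2
      have h3 : T.dist y z = T.dist y u + 1 := by
        rcases hT.dist_eq_dist_add_one_of_adj y huz with h | h <;> omega
      have h4 := dist_eq_add_length hT p hp.1 hp.2 huz h3
      have h5 : p.length = 0 := by omega
      rw [← SimpleGraph.Walk.eq_of_length_eq_zero h5]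
      exact huz
  -- A farthest node has no two neighbours, since only one of them could be closer. Hence it belongs
  -- to the class that contains the leaves.
  have hside : ∀ v ∈ T.center, ∃ y, side y = true ∧ ∀ v' ∈ T.center, ∀ x, T.dist v' x ≤ T.dist v y := by
    intro v hv
    obtain ⟨y, hy⟩ := far v
    refine ⟨y, ?_, hy⟩
    by_contra hs
    obtain ⟨a, b, hab, ha, hb⟩ := hdeg y (by simpa using hs)
    have h1 := hy v hv a
    have h2 := hy v hv b
    refine hab (closer_neighbor_unique hT (y := v) ha hb ?_ ?_)
    · have := hT.dist_ne_of_adj v ha; omega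
    · have := hT.dist_ne_of_adj v hb; omega
  obtain ⟨y, hys, hy⟩ := hside u hu
  obtain ⟨y', hys', hy'⟩ := hside w hw
  -- Walks of equal length from `u` and from `w` end in the same class, so `u` and `w` have the same
  -- class, although they are adjacent.
  have hr : T.dist u y = T.dist w y' := le_antisymm (hy' u hu y) (hy w hw y')
  obtain ⟨p, hp⟩ := (hT.connected u y).exists_walk_length_eq_dist
  obtain ⟨q, hq⟩ := (hT.connected w y').exists_walk_length_eq_dist
  have h1 := side.even_length_iff_congr p
  have h2 := side.even_length_iff_congr q
  rw [hp, hr, ← hq, h2, hys, hys'] at h1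
  have := side.valid hadj
  cases h3 : side u <;> cases h4 : side w <;> simp_all

end Center

/-! ### The centre of the decomposition tree, and the colouring defined from it. -/

section Graph

open scoped Classical

variable {V : Type*} {k : ℕ} {G : SimpleGraph V}

theorem IsKTree.exists_center_eq_singleton [Fintype V] (h : IsKTree k G)
    (hk : k < Fintype.card V) : ∃ R, (decompTree k G).center = {R} := by
  refine KTree.exists_center_eq_singleton (h.isTree hk)
    (SimpleGraph.Coloring.mk (fun M => decide (M.1.card = k + 1)) ?_) ?_
  · rintro M N (h | h) heq <;> simp only [decide_eq_decide] at heq <;> omega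
  · intro M hM
    have hM' : ¬ M.1.card = k + 1 := of_decide_eq_false hM
    exact Node.exists_ne_of_card (M.2.card.resolve_right hM')

/-! ### The colouring procedure -/

/-- Only the growing step needs an argument: `C` is injective on the `k`-clique, so just one colour
is free, and `C` uses it too. -/
theorem NodeColouring.eq_coloring {R : Node k G} {col : {v // v ∈ R.1} → Fin (k + 1)}
    (C : G.Coloring (Fin (k + 1))) (hC : ∀ v : {v // v ∈ R.1}, C v.1 = col v) {M : Node k G}
    {f : {v // v ∈ M.1} → Fin (k + 1)} (h : NodeColouring R col M f) : f = fun v => C v.1 := by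
  induction h with
  | root => exact funext fun v => (hC v).symm
  | shrink M S f hf hM hMS hsub ih => subst ih; rfl
  | grow M S f g hf hM hMS hsub hold hnew ih =>
    subst ih
    funext w
    by_cases hw : w.1 ∈ M.1
    · exact hold ⟨w.1, hw⟩
    · refine color_unique C (Node.isNClique_of_card hM) (fun u hu => hnew w hw ⟨u, hu⟩) ?_
      exact fun u hu => C.valid (S.2.isClique w.2 (hsub hu) (ne_of_mem_of_not_mem hu hw).symm)

/-- The second node on the path to the root is the parent, so induction on the path follows the
procedure downwards. -/
theorem NodeColouring.of_path {R : Node k G} {col : {v // v ∈ R.1} → Fin (k + 1)}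
    (C : G.Coloring (Fin (k + 1))) (hC : ∀ v : {v // v ∈ R.1}, C v.1 = col v) {M : Node k G}
    (p : (decompTree k G).Walk M R) (hp : p.IsPath) :
    NodeColouring R col M fun v => C v.1 := by
  induction p with
  | nil =>
    obtain rfl : (fun v => C v.1) = col := funext hC
    exact .root
  | @cons S M R hSM p ih =>
    have hchild : IsChild R M S :=
      ⟨hSM.symm, _, hp, by rw [SimpleGraph.Walk.support_cons]
                           exact List.mem_cons_of_mem _ p.start_mem_support⟩
    have h := ih hC ((SimpleGraph.Walk.cons_isPath_iff _ _).1 hp).1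
    rcases M.2.card with hM | hM
    · obtain ⟨h1, h2⟩ := decompTree_adj_of_card hSM.symm hM
      refine .grow M S _ _ h hM hchild h2 (fun u => rfl) fun w hw u => ?_
      exact C.valid (S.2.isClique w.2 (h2 u.2) (ne_of_mem_of_not_mem u.2 hw).symm)
    · exact .shrink M S _ h hM hchild (decompTree_adj_of_card_succ hSM.symm hM).2

theorem isProcedureColouring_of_coloring (hT : (decompTree k G).Connected) {R : Node k G}
    {col : {v // v ∈ R.1} → Fin (k + 1)} (C : G.Coloring (Fin (k + 1)))
    (hC : ∀ v : {v // v ∈ R.1}, C v.1 = col v) : IsProcedureColouring R col C := by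
  intro M f
  refine ⟨NodeColouring.eq_coloring C hC, ?_⟩
  rintro rfl
  obtain ⟨p, hp⟩ := (hT M R).exists_isPath
  exact .of_path C hC p hp

/-- The nodes cover all vertices, and on each node both colourings are the one that the procedure
yields. -/
theorem IsProcedureColouring.eq [Fintype V] (h : IsKTree k G) {R : Node k G}
    {col : {v // v ∈ R.1} → Fin (k + 1)} {c c' : V → Fin (k + 1)}
    (hc : IsProcedureColouring R col c) (hc' : IsProcedureColouring R col c') : c = c' := by
  funext v
  obtain ⟨M, -, hv⟩ := h.exists_mem_node (h.lt_card_of_node R) v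
  have h1 := (hc' M fun v => c v.1).1 ((hc M _).2 rfl)
  exact congrFun h1 ⟨v, hv⟩

/-- On the clique `R` a proper colouring and `col` are both injective, so a permutation of the
colours takes one to the other. -/
theorem IsKTree.exists_coloring_extending [Fintype V] (h : IsKTree k G) (R : Node k G)
    (col : (cliqueGraph G R).Coloring (Fin (k + 1))) :
    ∃ C : G.Coloring (Fin (k + 1)), ∀ v : {v // v ∈ R.1}, C v.1 = col v := by
  obtain ⟨c, hc⟩ := KTreeOn.exists_coloring h
  let C : G.Coloring (Fin (k + 1)) := SimpleGraph.Coloring.mk c fun {u v} huv =>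
    hc u (Finset.mem_univ _) v (Finset.mem_univ _) huv
  have hinj : Function.Injective fun v : {v // v ∈ R.1} => C v.1 := fun u v huv =>
    Subtype.ext (coloring_injOn C R.isNClique u.2 v.2 huv)
  have hcol : Function.Injective col := by
    intro u v huv
    by_contra hne
    exact col.valid (R.2.isClique u.2 v.2 (fun h => hne (Subtype.ext h))) huv
  obtain ⟨e, he⟩ := Equiv.Perm.exists_extending_pair _ _ hinj hcol
  refine ⟨SimpleGraph.Coloring.mk (fun v => e (C v)) fun {u v} huv heq => ?_, he⟩
  exact C.valid huv (e.injective heq)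

/-- The procedure colouring is the unique proper colouring that extends the colouring of the
root. -/
theorem IsKTree.exists_procedure_coloring [Fintype V] (h : IsKTree k G) (R : Node k G)
    (col : (cliqueGraph G R).Coloring (Fin (k + 1))) :
    ∃ C : G.Coloring (Fin (k + 1)),
      IsProcedureColouring R col C ∧
      (∀ c : V → Fin (k + 1), IsProcedureColouring R col c → c = C) ∧
      (∀ v : {v // v ∈ R.1}, C v.1 = col v) ∧
      (∀ C' : G.Coloring (Fin (k + 1)), (∀ v : {v // v ∈ R.1}, C' v.1 = col v) → C' = C) := by
  obtain ⟨C, hC⟩ := h.exists_coloring_extending R col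
  have hT := (h.isTree (h.lt_card_of_node R)).connected
  have hproc := isProcedureColouring_of_coloring hT C hC
  refine ⟨C, hproc, fun c hc => hc.eq h hproc, hC, fun C' hC' => ?_⟩
  exact DFunLike.coe_injective ((isProcedureColouring_of_coloring hT C' hC').eq h hproc)

/-! ### Isomorphism invariance -/

section Iso

variable {W : Type*} {H : SimpleGraph W}

theorem isNClique_map_iso (φ : G ≃g H) {m : ℕ} {M : Finset V} (hM : G.IsNClique m M) :
    H.IsNClique m (M.map φ.toEquiv.toEmbedding) := by
  refine ⟨?_, by rw [Finset.card_map, hM.2]⟩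
  intro x hx y hy hxy
  obtain ⟨u, hu, rfl⟩ := Finset.mem_map.1 hx
  obtain ⟨v, hv, rfl⟩ := Finset.mem_map.1 hy
  exact φ.map_adj_iff.2 (hM.1 hu hv fun h => hxy (by rw [h]))

theorem IsNode.map_iso (φ : G ≃g H) {M : Finset V} (hM : IsNode k G M) :
    IsNode k H (M.map φ.toEquiv.toEmbedding) := by
  rcases hM with h | ⟨h, A, B, hAB, hA, hB, h1, h2⟩
  · exact .inl (isNClique_map_iso φ h)
  · exact .inr ⟨isNClique_map_iso φ h, _, _, fun h => hAB (Finset.map_injective _ h),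
      isNClique_map_iso φ hA, isNClique_map_iso φ hB, Finset.map_subset_map.2 h1,
      Finset.map_subset_map.2 h2⟩

/-- The isomorphism of decomposition trees induced by an isomorphism of graphs. -/
def decompTreeIso (φ : G ≃g H) : decompTree k G ≃g decompTree k H where
  toFun M := ⟨M.1.map φ.toEquiv.toEmbedding, M.2.map_iso φ⟩
  invFun M := ⟨M.1.map φ.symm.toEquiv.toEmbedding, M.2.map_iso φ.symm⟩
  left_inv M := by
    refine Subtype.ext (Finset.ext fun x => ?_)
    simp only [Finset.mem_map_equiv]
    exact iff_of_eq (congrArg (· ∈ M.1) (φ.symm_apply_apply x))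
  right_inv M := by
    refine Subtype.ext (Finset.ext fun x => ?_)
    simp only [Finset.mem_map_equiv]
    exact iff_of_eq (congrArg (· ∈ M.1) (φ.apply_symm_apply x))
  map_rel_iff' := by
    intro M N
    simp [decompTree]

end Iso

theorem edist_map_iso_le {α β : Type*} {T : SimpleGraph α} {T' : SimpleGraph β} (e : T ≃g T')
    (u v : α) : T'.edist (e u) (e v) ≤ T.edist u v := by
  by_cases h : T.Reachable u v
  · obtain ⟨p, hp⟩ := h.exists_walk_length_eq_edist
    rw [← hp]
    have := SimpleGraph.edist_le (p.map e.toHom)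
    rwa [SimpleGraph.Walk.length_map] at this
  · rw [SimpleGraph.edist_eq_top_of_not_reachable h]
    exact le_top

theorem eccent_map_iso_le {α β : Type*} {T : SimpleGraph α} {T' : SimpleGraph β} (e : T ≃g T')
    (u : α) : T'.eccent (e u) ≤ T.eccent u := by
  rw [SimpleGraph.eccent_le_iff]
  intro v
  obtain ⟨w, rfl⟩ := e.surjective v
  exact (edist_map_iso_le e u w).trans SimpleGraph.edist_le_eccent

/-- A one-sided comparison of eccentricities is enough: it is applied to `e` at `u` and to `e.symm`
at all other nodes. -/
theorem map_iso_mem_center {α β : Type*} {T : SimpleGraph α} {T' : SimpleGraph β} (e : T ≃g T')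
    {u : α} (hu : u ∈ T.center) : e u ∈ T'.center := by
  rw [SimpleGraph.mem_center_iff] at hu ⊢
  refine le_antisymm ?_ SimpleGraph.radius_le_eccent
  refine ((eccent_map_iso_le e u).trans_eq hu).trans (le_iInf fun w => ?_)
  obtain ⟨v, rfl⟩ := e.surjective w
  refine SimpleGraph.radius_le_eccent.trans (?_ : T.eccent v ≤ _)
  simpa using eccent_map_iso_le e.symm (e v)

/-- The colouring of `H` pulled back along `φ` is a proper extension of `col`, and there is only
one. -/
theorem IsKTree.iso_invariant {W : Type*} [Fintype V] [Fintype W] {H : SimpleGraph W}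
    (hG : IsKTree k G) (hH : IsKTree k H) (φ : G ≃g H) (R : Node k G) (R' : Node k H)
    (hR : R ∈ (decompTree k G).center) (hR' : R' ∈ (decompTree k H).center) :
    R.1.map φ.toEquiv.toEmbedding = R'.1 ∧
      ∀ (col : (cliqueGraph G R).Coloring (Fin (k + 1)))
        (col' : (cliqueGraph H R').Coloring (Fin (k + 1))),
        (∀ (v : {v // v ∈ R.1}) (w : {w // w ∈ R'.1}), φ v.1 = w.1 → col' w = col v) →
        ∀ (c : V → Fin (k + 1)) (c' : W → Fin (k + 1)),
          IsProcedureColouring R col c → IsProcedureColouring R' col' c' →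
          ∀ v : V, c' (φ v) = c v := by
  obtain ⟨Z, hZ⟩ := hH.exists_center_eq_singleton (hH.lt_card_of_node R')
  have hmap : R.1.map φ.toEquiv.toEmbedding = R'.1 := by
    have h1 := map_iso_mem_center (decompTreeIso φ) hR
    rw [hZ, Set.mem_singleton_iff] at h1 hR'
    exact congrArg Subtype.val (h1.trans hR'.symm)
  refine ⟨hmap, fun col col' hcol c c' hc hc' v => ?_⟩
  obtain ⟨C, -, hC, -, huniq⟩ := hG.exists_procedure_coloring R col
  obtain ⟨C', -, hC', hext, -⟩ := hH.exists_procedure_coloring R' col'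
  obtain rfl := hC c hc
  obtain rfl := hC' c' hc'
  have := huniq (C'.comp φ.toHom) fun v => by
    have hv : φ v.1 ∈ R'.1 := by
      rw [← hmap]; exact Finset.mem_map_of_mem φ.toEquiv.toEmbedding v.2
    exact (hext ⟨φ v.1, hv⟩).trans (hcol v ⟨φ v.1, hv⟩ rfl)
  exact DFunLike.congr_fun this v

end Graph

end KTree

namespace KTree

/-! ### Machine fragments -/

section Machine

variable {α β ρ : Type}

/-- What a machine does in one step, apart from changing its state. -/
abbrev Action (β ρ : Type) : Type := Move × (ρ → Option Bool × Move) × Option β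

/-- A configuration of a machine with work tapes indexed by `ρ`, without the state. -/
structure Mem (β ρ : Type) where
  head : ℕ
  work : ρ → ℕ → Option Bool
  workHead : ρ → ℕ
  output : List β

/-- The effect of an action. -/
def Mem.apply (x : List α) (m : Mem β ρ) (a : Action β ρ) : Mem β ρ where
  head := min (a.1.apply m.head) (x.length + 1)
  work := fun i => Function.update (m.work i) (m.workHead i) (a.2.1 i).1
  workHead := fun i => (a.2.1 i).2.apply (m.workHead i)
  output := m.output ++ a.2.2.toList

/-- The symbols under the work heads. -/
def Mem.read (m : Mem β ρ) (i : ρ) : Option Bool := m.work i (m.workHead i)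

/-- A fragment of a machine that is left with a value of type `E`. -/
structure Frag (α β ρ E : Type) where
  State : Type
  finState : Finite State
  start : State
  trans : State → InputSymbol α → (ρ → Option Bool) → (State ⊕ E) × Action β ρ

namespace Frag

variable {E E' S : Type} {x : List α} {L : ℕ}

/-- `F.Run x L q m e m'`: started in the state `q` with memory `m` on the input `x`, the fragment is
left with the value `e` and memory `m'`, and before that all work heads stay within the cells
`0, …, L`. -/
inductive Run (F : Frag α β ρ E) (x : List α) (L : ℕ) :
    F.State → Mem β ρ → E → Mem β ρ → Prop
  | exit {q : F.State} {m : Mem β ρ} {e : E} {a : Action β ρ} (hm : ∀ i, m.workHead i ≤ L)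
      (h : F.trans q (readInput x m.head) m.read = (.inr e, a)) : Run F x L q m e (m.apply x a)
  | next {q q' : F.State} {m m' : Mem β ρ} {e : E} {a : Action β ρ}
      (hm : ∀ i, m.workHead i ≤ L)
      (h : F.trans q (readInput x m.head) m.read = (.inl q', a))
      (h' : Run F x L q' (m.apply x a) e m') : Run F x L q m e m'

/-- `F.Exec x L m e m'`: as `Frag.Run`, from the initial state of the fragment. -/
def Exec (F : Frag α β ρ E) (x : List α) (L : ℕ) (m : Mem β ρ) (e : E) (m' : Mem β ρ) : Prop :=
  F.Run x L F.start m e m'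

/-- A single step. -/
def act (g : InputSymbol α → (ρ → Option Bool) → E × Action β ρ) : Frag α β ρ E where
  State := Unit
  finState := inferInstance
  start := ()
  trans := fun _ s w => (.inr (g s w).1, (g s w).2)

theorem exec_act {g : InputSymbol α → (ρ → Option Bool) → E × Action β ρ} {m : Mem β ρ}
    (hm : ∀ i, m.workHead i ≤ L) :
    (act g).Exec x L m (g (readInput x m.head) m.read).1
      (m.apply x (g (readInput x m.head) m.read).2) :=
  .exit hm rfl

/-- Sequential composition. -/
def bind [Finite E] (F : Frag α β ρ E) (K : E → Frag α β ρ E') : Frag α β ρ E' where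
  State := F.State ⊕ Σ e, (K e).State
  finState := by
    have := F.finState
    have := fun e => (K e).finState
    infer_instance
  start := .inl F.start
  trans
    | .inl q, s, w =>
      ((F.trans q s w).1.elim (fun q' => .inl (.inl q')) (fun e => .inl (.inr ⟨e, (K e).start⟩)),
        (F.trans q s w).2)
    | .inr q, s, w =>
      (((K q.1).trans q.2 s w).1.map (fun q' => .inr ⟨q.1, q'⟩) id, ((K q.1).trans q.2 s w).2)

theorem Exec.bind [Finite E] {F : Frag α β ρ E} {K : E → Frag α β ρ E'} {m m' m'' : Mem β ρ}
    {e : E} {e' : E'} (hF : F.Exec x L m e m') (hK : (K e).Exec x L m' e' m'') :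
    (F.bind K).Exec x L m e' m'' := by
  have h2 : ∀ q m, (K e).Run x L q m e' m'' →
      (F.bind K).Run x L (.inr ⟨e, q⟩) m e' m'' := by
    intro q m h
    clear hK
    induction h with
    | exit hm h => exact .exit hm (by simp [Frag.bind, h])
    | next hm h h' ih => exact .next hm (by simp only [Frag.bind, h]; rfl) ih
  suffices h1 : ∀ q, F.Run x L q m e m' → (F.bind K).Run x L (.inl q) m e' m'' from h1 _ hF
  intro q h
  clear hF
  induction h with
  | exit hm h => exact .next hm (by simp only [Frag.bind, h]; rfl) (h2 _ _ hK)
  | next hm h h' ih => exact .next hm (by simp only [Frag.bind, h]; rfl) (ih hK h2)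

/-- Iteration of a fragment until it is left with a value of type `E`. -/
def loop [Finite S] (F : S → Frag α β ρ (S ⊕ E)) (s : S) : Frag α β ρ E where
  State := Σ s, (F s).State
  finState := by
    have := fun s => (F s).finState
    infer_instance
  start := ⟨s, (F s).start⟩
  trans := fun q t w =>
    (((F q.1).trans q.2 t w).1.elim (fun q' => .inl ⟨q.1, q'⟩)
      (Sum.map (fun s => ⟨s, (F s).start⟩) id), ((F q.1).trans q.2 t w).2)

theorem Exec.loop_exit [Finite S] {F : S → Frag α β ρ (S ⊕ E)} {s : S} {m m' : Mem β ρ} {e : E}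
    (h : (F s).Exec x L m (.inr e) m') : (loop F s).Exec x L m e m' := by
  suffices ∀ q, (F s).Run x L q m (.inr e) m' → (loop F s).Run x L ⟨s, q⟩ m e m' from this _ h
  clear h
  intro q h
  generalize he : (Sum.inr e : S ⊕ E) = e' at h
  induction h with
  | exit hm h => subst he; exact .exit hm (by simp [loop, h])
  | next hm h h' ih => exact .next hm (by simp only [loop, h]; rfl) (ih he)

/-- The value `s` enters a loop only through its initial state; states and transitions are the same
for all values. -/
theorem Run.loop_start [Finite S] {F : S → Frag α β ρ (S ⊕ E)} {s s' : S} {m m' : Mem β ρ}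
    {e : E} {q : (loop F s').State} (h : (loop F s').Run x L q m e m') :
    (loop F s).Run x L q m e m' := by
  induction h with
  | exit hm h => exact .exit hm h
  | next hm h _ ih => exact .next hm h ih

theorem Exec.loop_next [Finite S] {F : S → Frag α β ρ (S ⊕ E)} {s s' : S} {m m' m'' : Mem β ρ}
    {e : E} (h : (F s).Exec x L m (.inl s') m') (h' : (loop F s').Exec x L m' e m'') :
    (loop F s).Exec x L m e m'' := by
  suffices ∀ q, (F s).Run x L q m (.inl s') m' → (loop F s).Run x L ⟨s, q⟩ m e m'' from this _ h
  clear h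
  intro q h
  generalize he : (Sum.inl s' : S ⊕ E) = e' at h
  induction h with
  | exit hm h =>
    subst he
    exact .next hm (by simp only [loop, h]; rfl) (Run.loop_start (s := s) (s' := s') h')
  | next hm h _ ih => exact .next hm (by simp only [loop, h]; rfl) (ih h' he)

/-- The machine that runs a fragment and halts. -/
def toTransducer [Finite ρ] (F : Frag α β ρ E) : Transducer α β where
  State := Option F.State
  finState := by
    have := F.finState
    infer_instance
  start := some F.start
  Work := Option Bool
  finWork := inferInstance
  blank := none
  Tape := ρ
  finTape := inferInstance
  trans
    | none, _, _ => none
    | some q, s, w =>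
      some ((F.trans q s w).1.elim some (fun _ => none), (F.trans q s w).2.1,
        (F.trans q s w).2.2.1, (F.trans q s w).2.2.2)

/-- The configuration of the machine with a given state and memory. -/
def toCfg [Finite ρ] (F : Frag α β ρ E) (q : Option F.State) (m : Mem β ρ) :
    F.toTransducer.Cfg where
  state := q
  inputHead := m.head
  work := m.work
  workHead := m.workHead
  output := m.output

theorem step_toCfg [Finite ρ] (F : Frag α β ρ E) (q : F.State) (m : Mem β ρ) :
    F.toTransducer.step x (F.toCfg (some q) m) =
      some (F.toCfg ((F.trans q (readInput x m.head) m.read).1.elim some (fun _ => none))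
        (m.apply x (F.trans q (readInput x m.head) m.read).2)) := rfl

/-- `Run` checks the heads before each step, so the halting configuration is exempt from the bound
and is listed separately. -/
theorem Run.reaches [Finite ρ] {F : Frag α β ρ E} {q : F.State} {m m' : Mem β ρ} {e : E}
    (h : F.Run x L q m e m') :
    StateTransition.Reaches (F.toTransducer.step x) (F.toCfg (some q) m) (F.toCfg none m') ∧
      ∀ c, StateTransition.Reaches (F.toTransducer.step x) (F.toCfg (some q) m) c →
        (∀ i, c.workHead i ≤ L) ∨ c = F.toCfg none m' := by
  induction h with
  | @exit q m e a hm h =>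
    have hs : F.toTransducer.step x (F.toCfg (some q) m) =
        some (F.toCfg none (m.apply x a)) := by rw [step_toCfg, h]; rfl
    refine ⟨Relation.ReflTransGen.single hs, fun c hc => ?_⟩
    rcases Relation.ReflTransGen.cases_head hc with rfl | ⟨d, hd, hdc⟩
    · exact .inl hm
    · obtain rfl := Option.some.inj (hs.symm.trans hd)
      rcases Relation.ReflTransGen.cases_head hdc with rfl | ⟨d, hd, -⟩
      · exact .inr rfl
      · exact absurd hd (Option.not_mem_none d)
  | @next q q' m m' e a hm h h' ih =>
    have hs : F.toTransducer.step x (F.toCfg (some q) m) =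
        some (F.toCfg (some q') (m.apply x a)) := by rw [step_toCfg, h]; rfl
    refine ⟨Relation.ReflTransGen.head hs ih.1, fun c hc => ?_⟩
    rcases Relation.ReflTransGen.cases_head hc with rfl | ⟨d, hd, hdc⟩
    · exact .inl hm
    · obtain rfl := Option.some.inj (hs.symm.trans hd)
      exact ih.2 c hdc

end Frag

/-- The memory at the beginning of a computation. -/
def Mem.init : Mem β ρ := ⟨0, fun _ _ => none, fun _ => 0, []⟩

theorem logspaceComputable_of_frag {E : Type} [Finite ρ] (F : Frag α β ρ E)
    (f : List α → List β) (C : ℕ)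
    (h : ∀ x, ∃ (e : E) (m : Mem β ρ), F.Exec x (C * (Nat.log 2 x.length + 1)) Mem.init e m ∧
      (∀ i, m.workHead i = 0) ∧ m.output = f x) : LogspaceComputable f := by
  refine ⟨F.toTransducer, fun x => ?_, C, fun x c hc i => ?_⟩
  · obtain ⟨e, m, he, -, ho⟩ := h x
    exact ⟨F.toCfg none m, StateTransition.mem_eval.2 ⟨he.reaches.1, rfl⟩, ho⟩
  · obtain ⟨e, m, he, hh, -⟩ := h x
    rcases he.reaches.2 c hc with h' | rfl
    · exact h' i
    · exact (hh i).trans_le (Nat.zero_le _)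

end Machine

end KTree

namespace KTree

/-! ### Binary counters -/

section Binary

/-- The successor of a binary number, least significant bit first. -/
def binSucc : List Bool → List Bool
  | [] => [true]
  | false :: l => true :: l
  | true :: l => false :: binSucc l

/-- The binary representation of a number, least significant bit first. -/
def bin : ℕ → List Bool
  | 0 => []
  | n + 1 => binSucc (bin n)

/-- The number with a given binary representation. -/
def binValue : List Bool → ℕ
  | [] => 0
  | b :: l => b.toNat + 2 * binValue l

theorem binValue_binSucc (l : List Bool) : binValue (binSucc l) = binValue l + 1 := by
  induction l with
  | nil => rfl
  | cons b l ih =>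
    cases b <;> simp only [binSucc, binValue, Bool.toNat_true, Bool.toNat_false]
    · omega
    · rw [ih]; omega

theorem binValue_bin (n : ℕ) : binValue (bin n) = n := by
  induction n with
  | zero => rfl
  | succ n ih => rw [bin, binValue_binSucc, ih]

theorem bin_injective : Function.Injective bin := fun m n h => by
  rw [← binValue_bin m, h, binValue_bin]

/-- For a nonempty word the inequality says that the most significant bit is `true`. The successor
keeps this, which bounds the length of `bin n` by a logarithm. -/
theorem two_pow_length_binSucc {l : List Bool} (h : l = [] ∨ 2 ^ l.length ≤ 2 * binValue l) :
    2 ^ (binSucc l).length ≤ 2 * binValue (binSucc l) := by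
  induction l with
  | nil => simp [binSucc, binValue]
  | cons b l ih =>
    have h' := h.resolve_left (List.cons_ne_nil _ _)
    cases b
    · simp only [binSucc, binValue, List.length_cons, Bool.toNat_true, Bool.toNat_false] at h' ⊢
      omega
    · simp only [binSucc, binValue, List.length_cons, Bool.toNat_true, Bool.toNat_false,
        pow_succ] at h' ⊢
      have := ih (by
        rcases l with _ | ⟨c, l⟩
        · exact .inl rfl
        · right
          simp only [List.length_cons, pow_succ] at h' ⊢
          omega)
      omega

theorem two_pow_length_bin (n : ℕ) : 2 ^ (bin (n + 1)).length ≤ 2 * (n + 1) := by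
  have h : ∀ n, bin n = [] ∨ 2 ^ (bin n).length ≤ 2 * binValue (bin n) := by
    intro n
    induction n with
    | zero => exact .inl rfl
    | succ n ih => exact .inr (two_pow_length_binSucc ih)
  have h' := two_pow_length_binSucc (h n)
  rwa [binValue_binSucc, binValue_bin] at h'

theorem length_bin_le (n : ℕ) : (bin n).length ≤ Nat.log 2 n + 1 := by
  rcases n with _ | n
  · simp [bin]
  · have h := two_pow_length_bin n
    have h1 : (bin (n + 1)).length ≤ Nat.log 2 (2 * (n + 1)) :=
      Nat.le_log_of_pow_le one_lt_two h
    rwa [mul_comm, Nat.log_mul_base one_lt_two (Nat.succ_ne_zero n)] at h1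

theorem length_bin_mono {m n : ℕ} (h : m ≤ n) : (bin m).length ≤ Nat.log 2 n + 1 :=
  (length_bin_le m).trans (Nat.succ_le_succ (Nat.log_mono_right h))

/-- The tape with a given word in the cells `1, 2, …`. -/
def tapeOf (t : List Bool) (p : ℕ) : Option Bool := if p = 0 then none else t[p - 1]?

@[simp] theorem tapeOf_zero (t : List Bool) : tapeOf t 0 = none := rfl

@[simp] theorem tapeOf_succ (t : List Bool) (p : ℕ) : tapeOf t (p + 1) = t[p]? := rfl

theorem update_tapeOf_self (t : List Bool) (p : ℕ) :
    Function.update (tapeOf t) p (tapeOf t p) = tapeOf t := Function.update_eq_self _ _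

theorem update_tapeOf_set (u v : List Bool) (b c : Bool) :
    Function.update (tapeOf (u ++ b :: v)) (u.length + 1) (some c) = tapeOf (u ++ c :: v) := by
  funext p
  rcases p with _ | p
  · rfl
  · by_cases hp : p = u.length
    · subst hp; simp
    · rw [Function.update_of_ne (by omega)]
      simp only [tapeOf_succ]
      rcases lt_or_gt_of_ne hp with h | h
      · rw [List.getElem?_append_left h, List.getElem?_append_left h]
      · rw [List.getElem?_append_right h.le, List.getElem?_append_right h.le]
        obtain ⟨d, hd⟩ := Nat.exists_eq_succ_of_ne_zero (Nat.sub_ne_zero_of_lt h)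
        rw [hd]; rfl

theorem update_tapeOf_append (u : List Bool) (c : Bool) :
    Function.update (tapeOf u) (u.length + 1) (some c) = tapeOf (u ++ [c]) := by
  funext p
  rcases p with _ | p
  · rfl
  · by_cases hp : p = u.length
    · subst hp; simp
    · rw [Function.update_of_ne (by omega)]
      simp only [tapeOf_succ]
      rcases lt_or_gt_of_ne hp with h | h
      · rw [List.getElem?_append_left h]
      · rw [List.getElem?_append_right h.le, List.getElem?_eq_none h.le,
          List.getElem?_eq_none (by simp; omega)]

theorem update_tapeOf_dropLast (u : List Bool) (c : Bool) :
    Function.update (tapeOf (u ++ [c])) (u.length + 1) none = tapeOf u := by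
  rw [← update_tapeOf_append, Function.update_idem]
  conv_rhs => rw [← update_tapeOf_self u (u.length + 1)]
  simp

end Binary

/-! ### Elementary fragments -/

section Registers

variable {α β ρ E : Type} {x : List α} {L : ℕ}

/-- The memory with the head of the input tape at `h`, the words `l i` on the work tapes, the work
heads at `p i`, and output `o`. -/
def regMem (h : ℕ) (l : ρ → List Bool) (p : ρ → ℕ) (o : List β) : Mem β ρ :=
  ⟨h, fun i => tapeOf (l i), p, o⟩

/-- The memory whose work tapes hold the numbers `σ i`. -/
def store (h : ℕ) (σ : ρ → ℕ) (o : List β) : Mem β ρ :=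
  regMem h (fun i => bin (σ i)) (fun _ => 0) o

theorem Frag.exec_act_regMem {g : InputSymbol α → (ρ → Option Bool) → E × Action β ρ} {h : ℕ}
    {l : ρ → List Bool} {p : ρ → ℕ} {o : List β} {e : E} {a : Action β ρ} {h' : ℕ}
    {l' : ρ → List Bool} {p' : ρ → ℕ} {o' : List β} (hL : ∀ i, p i ≤ L)
    (hg : g (readInput x h) (fun i => tapeOf (l i) (p i)) = (e, a))
    (hh : min (a.1.apply h) (x.length + 1) = h')
    (hl : ∀ i, Function.update (tapeOf (l i)) (p i) (a.2.1 i).1 = tapeOf (l' i))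
    (hp : ∀ i, (a.2.1 i).2.apply (p i) = p' i) (ho : o ++ a.2.2.toList = o') :
    (act g).Exec x L (regMem h l p o) e (regMem h' l' p' o') := by
  have h1 := exec_act (x := x) (g := g) (m := regMem h l p o) hL
  have h2 : g (readInput x (regMem h l p o).head) (regMem h l p o).read = (e, a) := hg
  have h3 : (regMem h l p o).apply x a = regMem h' l' p' o' := by
    simp only [Mem.apply, regMem, Mem.mk.injEq]
    exact ⟨hh, funext hl, funext hp, ho⟩
  rwa [h2, h3] at h1

namespace Frag

/-- Do nothing. -/
def pure (e : E) : Frag α β ρ E :=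
  act fun _ w => (e, .stay, fun i => (w i, .stay), none)

/-- Read and move the input head. -/
def inputAct (g : InputSymbol α → E × Move) : Frag α β ρ E :=
  act fun s w => ((g s).1, (g s).2, fun i => (w i, .stay), none)

/-- Write to the output tape. -/
def emit (b : Option β) : Frag α β ρ Unit :=
  act fun _ w => ((), .stay, fun i => (w i, .stay), b)

theorem exec_pure {h : ℕ} {l : ρ → List Bool} {p : ρ → ℕ} {o : List β} (e : E)
    (hh : h ≤ x.length + 1) (hp : ∀ i, p i ≤ L) :
    (pure e : Frag α β ρ E).Exec x L (regMem h l p o) e (regMem h l p o) :=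
  exec_act_regMem hp rfl (min_eq_left hh) (fun _ => update_tapeOf_self _ _) (fun _ => rfl)
    (List.append_nil o)

theorem exec_emit {h : ℕ} {l : ρ → List Bool} {p : ρ → ℕ} {o : List β} (b : Option β)
    (hh : h ≤ x.length + 1) (hp : ∀ i, p i ≤ L) :
    (emit b : Frag α β ρ Unit).Exec x L (regMem h l p o) () (regMem h l p (o ++ b.toList)) :=
  exec_act_regMem hp rfl (min_eq_left hh) (fun _ => update_tapeOf_self _ _) (fun _ => rfl) rfl

theorem exec_inputAct {h : ℕ} {l : ρ → List Bool} {p : ρ → ℕ} {o : List β}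
    {g : InputSymbol α → E × Move} {e : E} {mv : Move} (hp : ∀ i, p i ≤ L)
    (hg : g (readInput x h) = (e, mv)) :
    (inputAct g : Frag α β ρ E).Exec x L (regMem h l p o) e
      (regMem (min (mv.apply h) (x.length + 1)) l p o) :=
  exec_act_regMem (a := (mv, fun i => (tapeOf (l i) (p i), .stay), none)) hp
    (by rw [hg]) rfl (fun _ => update_tapeOf_self _ _) (fun _ => rfl) (List.append_nil o)

/-! ### Operations on the input head -/

/-- Move the input head to the right. -/
def right : Frag α β ρ Unit := inputAct fun _ => ((), .right)

theorem exec_right {h : ℕ} {σ : ρ → ℕ} {o : List β} :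
    (right : Frag α β ρ Unit).Exec x L (store h σ o) ()
      (store (min (h + 1) (x.length + 1)) σ o) :=
  exec_inputAct (mv := .right) (fun _ => Nat.zero_le _) rfl

/-- Move the input head to the left end. -/
def leftEnd (e : E) : Frag α β ρ E :=
  loop (fun _ : Unit => inputAct fun s =>
    match s with
    | .leftEnd => (.inr e, .stay)
    | _ => (.inl (), .left)) ()

theorem exec_leftEnd {h : ℕ} {σ : ρ → ℕ} {o : List β} (e : E) (hh : h ≤ x.length + 1) :
    (leftEnd e : Frag α β ρ E).Exec x L (store h σ o) e (store 0 σ o) := by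
  induction h with
  | zero => exact Exec.loop_exit (exec_inputAct (mv := .stay) (fun _ => Nat.zero_le _) rfl)
  | succ h ih =>
    have h1 : min (Move.left.apply (h + 1)) (x.length + 1) = h := by simp [Move.apply]; omega
    have h2 := exec_inputAct (x := x) (L := L) (h := h + 1) (l := fun i => bin (σ i))
      (p := fun _ => 0) (o := o) (mv := .left) (e := (.inl () : Unit ⊕ E))
      (g := fun s => match s with
        | .leftEnd => (.inr e, .stay)
        | _ => (.inl (), .left)) (fun _ => Nat.zero_le _) (by
          simp only [readInput, Nat.succ_ne_zero, if_false]
          cases x[h + 1 - 1]? <;> rfl)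
    rw [h1] at h2
    exact Exec.loop_next h2 (ih (by omega))

end Frag

variable [DecidableEq ρ]

/-- As `regMem`, with the word `t` on tape `r`, whose head is at `j`; the other work heads are at
cell `0`. -/
def oneMem (h : ℕ) (l : ρ → List Bool) (o : List β) (r : ρ) (t : List Bool) (j : ℕ) : Mem β ρ :=
  regMem h (Function.update l r t) (Function.update (fun _ => 0) r j) o

/-- As `regMem`, with the heads of the tapes `r` and `r'` at `j`, and the other work heads at cell
`0`. -/
def twoMem (h : ℕ) (l : ρ → List Bool) (o : List β) (r r' : ρ) (j : ℕ) : Mem β ρ :=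
  regMem h l (fun i => if i = r ∨ i = r' then j else 0) o

theorem store_eq_oneMem (h : ℕ) (σ : ρ → ℕ) (o : List β) (r : ρ) (n : ℕ) :
    store h (Function.update σ r n) o = oneMem h (fun i => bin (σ i)) o r (bin n) 0 := by
  have h1 : (fun i => bin (Function.update σ r n i)) =
      Function.update (fun i => bin (σ i)) r (bin n) := by
    funext i
    by_cases hi : i = r
    · subst hi; simp
    · simp [hi]
  have h2 : Function.update (fun _ : ρ => 0) r 0 = fun _ => 0 :=
    Function.update_eq_self r fun _ => 0
  rw [store, oneMem, h1, h2]

theorem store_eq_oneMem_self (h : ℕ) (σ : ρ → ℕ) (o : List β) (r : ρ) :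
    store h σ o = oneMem h (fun i => bin (σ i)) o r (bin (σ r)) 0 := by
  rw [← store_eq_oneMem, Function.update_eq_self]

theorem twoMem_zero (h : ℕ) (l : ρ → List Bool) (o : List β) (r r' : ρ) :
    twoMem h l o r r' 0 = regMem h l (fun _ => 0) o := by
  simp [twoMem]


namespace Frag

/-- Read, write and move on one work tape. -/
def regAct (r : ρ) (g : Option Bool → E × Option Bool × Move) : Frag α β ρ E :=
  act fun _ w => ((g (w r)).1, .stay, fun i => if i = r then (g (w r)).2 else (w i, .stay), none)

/-- Read two work tapes and move their heads. -/
def regAct₂ (r r' : ρ) (g : Option Bool → Option Bool → E × Move) : Frag α β ρ E :=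
  act fun _ w => ((g (w r) (w r')).1, .stay,
    fun i => (w i, if i = r ∨ i = r' then (g (w r) (w r')).2 else .stay), none)

theorem exec_regAct {h : ℕ} {l : ρ → List Bool} {o : List β} {r : ρ} {t t' : List Bool} {j : ℕ}
    {g : Option Bool → E × Option Bool × Move} {e : E} {b : Option Bool} {mv : Move}
    (hh : h ≤ x.length + 1) (hj : j ≤ L) (hg : g (tapeOf t j) = (e, b, mv))
    (ht : Function.update (tapeOf t) j b = tapeOf t') :
    (regAct r g : Frag α β ρ E).Exec x L (oneMem h l o r t j) e
      (oneMem h l o r t' (mv.apply j)) := by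
  refine exec_act_regMem (a := (.stay, fun i => if i = r then (b, mv) else
    (tapeOf (Function.update l r t i) (Function.update (fun _ => 0) r j i), .stay), none))
    ?_ ?_ (min_eq_left hh) ?_ ?_ (List.append_nil o)
  · intro i
    by_cases hi : i = r
    · subst hi; simpa using hj
    · simp [hi]
  · simp [hg]
  · intro i
    by_cases hi : i = r
    · subst hi; simpa using ht
    · simp only [hi, if_false]
      rw [update_tapeOf_self, Function.update_of_ne hi, Function.update_of_ne hi]
  · intro i
    by_cases hi : i = r
    · subst hi; simp
    · simp [hi, Move.apply]

theorem exec_regAct₂ {h : ℕ} {l : ρ → List Bool} {o : List β} {r r' : ρ} {j : ℕ}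
    {g : Option Bool → Option Bool → E × Move} {e : E} {mv : Move}
    (hh : h ≤ x.length + 1) (hj : j ≤ L) (hg : g (tapeOf (l r) j) (tapeOf (l r') j) = (e, mv)) :
    (regAct₂ r r' g : Frag α β ρ E).Exec x L (twoMem h l o r r' j) e
      (twoMem h l o r r' (mv.apply j)) := by
  refine exec_act_regMem (a := (.stay, fun i => (tapeOf (l i) (if i = r ∨ i = r' then j else 0),
    if i = r ∨ i = r' then mv else .stay), none))
    ?_ ?_ (min_eq_left hh) (fun _ => update_tapeOf_self _ _) ?_ (List.append_nil o)
  · intro i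
    by_cases hi : i = r ∨ i = r'
    · simpa [hi] using hj
    · simp [hi]
  · simp [hg]
  · intro i
    by_cases hi : i = r ∨ i = r'
    · simp [hi]
    · simp [hi, Move.apply]

/-! ### Operations on registers -/

/-- Bring the head of a work tape back to cell `0`. -/
def rewind (r : ρ) : Frag α β ρ Unit :=
  loop (fun _ : Unit => regAct r fun b =>
    if b = none then (.inr (), b, .stay) else (.inl (), b, .left)) ()

theorem exec_rewind {h : ℕ} {l : ρ → List Bool} {o : List β} {r : ρ} {t : List Bool}
    (hh : h ≤ x.length + 1) (ht : t.length ≤ L) {j : ℕ} (hj : j ≤ t.length) :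
    (rewind r : Frag α β ρ Unit).Exec x L (oneMem h l o r t j) () (oneMem h l o r t 0) := by
  induction j with
  | zero => exact Exec.loop_exit (exec_regAct (mv := .stay) hh (Nat.zero_le _) rfl (update_tapeOf_self _ _))
  | succ j ih =>
    refine Exec.loop_next (s' := ()) (exec_regAct (mv := .left) hh (hj.trans ht) ?_
      (update_tapeOf_self _ _)) (ih (by omega))
    rw [if_neg (by simp; omega)]

/-- Add one to a register. -/
def inc (r : ρ) : Frag α β ρ Unit :=
  (regAct r fun b => ((), b, .right)).bind fun _ =>
    (loop (fun _ : Unit => regAct r fun b =>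
      if b = some true then (.inl (), some false, .right) else (.inr (), some true, .stay))
      ()).bind fun _ => rewind r

theorem exec_inc {h : ℕ} {σ : ρ → ℕ} {o : List β} (r : ρ) (hh : h ≤ x.length + 1)
    (hL : (bin (σ r)).length + 1 ≤ L) :
    (inc r : Frag α β ρ Unit).Exec x L (store h σ o) ()
      (store h (Function.update σ r (σ r + 1)) o) := by
  rw [store_eq_oneMem, store_eq_oneMem_self h σ o r, bin]
  generalize bin (σ r) = t at hL
  refine (exec_regAct (mv := .right) hh (Nat.zero_le _) rfl (update_tapeOf_self _ _)).bind ?_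
  -- The carry has passed `u` and is about to enter `v`. Where the head stops is immaterial, as it
  -- is rewound afterwards.
  have key : ∀ v u : List Bool, u.length + v.length + 1 ≤ L →
      ∃ j ≤ (u ++ binSucc v).length, (u ++ binSucc v).length ≤ L ∧
      (loop (fun _ : Unit => regAct r fun b =>
      if b = some true then (.inl (), some false, .right) else (.inr (), some true, .stay))
      () : Frag α β ρ Unit).Exec x L (oneMem h (fun i => bin (σ i)) o r (u ++ v) (u.length + 1)) ()
        (oneMem h (fun i => bin (σ i)) o r (u ++ binSucc v) j) := by
    intro v
    induction v with
    | nil =>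
      intro u hu
      refine ⟨u.length + 1, by simp [binSucc], by simpa [binSucc] using hu, Exec.loop_exit ?_⟩
      refine exec_regAct (b := some true) (mv := .stay) hh (by omega) (by simp) ?_
      rw [List.append_nil]; exact update_tapeOf_append u true
    | cons b v ih =>
      intro u hu
      rw [List.length_cons] at hu
      cases b
      · refine ⟨u.length + 1, by simp [binSucc], by simp [binSucc]; omega, Exec.loop_exit ?_⟩
        exact exec_regAct (b := some true) (mv := .stay) hh (by omega) (by simp) (update_tapeOf_set _ _ _ _)
      · obtain ⟨j, hj, hjL, he⟩ := ih (u ++ [false]) (by simp; omega)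
        simp only [List.append_assoc, List.singleton_append, List.length_append,
          List.length_singleton] at hj hjL he
        refine ⟨j, by simpa [binSucc] using hj, by simpa [binSucc] using hjL,
          Exec.loop_next (s' := ()) ?_ he⟩
        exact exec_regAct (mv := .right) hh (by omega) (by simp) (update_tapeOf_set _ _ _ _)
  obtain ⟨j, hj, hjL, he⟩ := key t [] (by simpa using hL)
  exact he.bind (exec_rewind hh hjL hj)

/-- Set a register to zero. -/
def zero (r : ρ) : Frag α β ρ Unit :=
  (regAct r fun b => ((), b, .right)).bind fun _ =>
    (loop (fun _ : Unit => regAct r fun b =>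
      if b = none then (.inr (), b, .left) else (.inl (), b, .right)) ()).bind fun _ =>
    loop (fun _ : Unit => regAct r fun b =>
      if b = none then (.inr (), none, .stay) else (.inl (), none, .left)) ()

theorem exec_zero {h : ℕ} {σ : ρ → ℕ} {o : List β} (r : ρ) (hh : h ≤ x.length + 1)
    (hL : (bin (σ r)).length + 1 ≤ L) :
    (zero r : Frag α β ρ Unit).Exec x L (store h σ o) () (store h (Function.update σ r 0) o) := by
  rw [store_eq_oneMem, store_eq_oneMem_self h σ o r, bin]
  generalize bin (σ r) = t at hL
  refine (exec_regAct (mv := .right) hh (Nat.zero_le _) rfl (update_tapeOf_self _ _)).bind ?_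
  -- The first loop runs to the blank behind the word and steps back; the second erases leftwards
  -- until it meets the blank cell `0`.
  have h1 : ∀ d j, j + d = t.length →
      (loop (fun _ : Unit => regAct r fun b =>
      if b = none then (.inr (), b, .left) else (.inl (), b, .right)) () :
      Frag α β ρ Unit).Exec x L (oneMem h (fun i => bin (σ i)) o r t (j + 1)) ()
        (oneMem h (fun i => bin (σ i)) o r t t.length) := by
    intro d
    induction d with
    | zero =>
      rintro j rfl
      refine Exec.loop_exit (exec_regAct (mv := .left) hh (by omega) ?_ (update_tapeOf_self _ _))
      rw [if_pos (by simp)]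
    | succ d ih =>
      intro j hj
      refine Exec.loop_next (s' := ()) (exec_regAct (mv := .right) hh (by omega) ?_
        (update_tapeOf_self _ _)) (ih (j + 1) (by omega))
      rw [if_neg (by simp; omega)]
  refine (h1 t.length 0 (by simp)).bind ?_
  clear h1
  induction t using List.reverseRecOn with
  | nil => exact Exec.loop_exit (exec_regAct (mv := .stay) hh (Nat.zero_le _) rfl (update_tapeOf_self _ _))
  | append_singleton t b ih =>
    rw [List.length_append, List.length_singleton] at hL ⊢
    refine Exec.loop_next (s' := ()) (exec_regAct (mv := .left) hh (by omega) ?_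
      (update_tapeOf_dropLast t b)) (ih (by omega))
    rw [if_neg (by simp)]

/-- Compare two registers. -/
def eq (r r' : ρ) : Frag α β ρ Bool :=
  (regAct₂ r r' fun _ _ => ((), .right)).bind fun _ =>
    (loop (fun _ : Unit => regAct₂ r r' fun a b =>
      if a = b then if a = none then (.inr true, .left) else (.inl (), .right)
      else (.inr false, .left)) ()).bind fun e =>
    loop (fun _ : Unit => regAct₂ r r' fun a _ =>
      if a = none then (.inr e, .stay) else (.inl (), .left)) ()

/-- The two heads move in parallel and stop at the first difference, so the length of the first word
alone bounds the space. -/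
theorem exec_eq {h : ℕ} {σ : ρ → ℕ} {o : List β} (r r' : ρ) (hh : h ≤ x.length + 1)
    (hL : (bin (σ r)).length + 1 ≤ L) :
    (eq r r' : Frag α β ρ Bool).Exec x L (store h σ o) (decide (σ r = σ r')) (store h σ o) := by
  rw [store, ← twoMem_zero _ _ _ r r']
  have hdec : decide (σ r = σ r') = decide (bin (σ r) = bin (σ r')) := by
    simp [bin_injective.eq_iff]
  rw [hdec]
  generalize hl : (fun i => bin (σ i)) = l
  have e1 : bin (σ r) = l r := by rw [← hl]
  have e2 : bin (σ r') = l r' := by rw [← hl]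
  rw [e1] at hL ⊢
  rw [e2]
  refine (exec_regAct₂ (mv := .right) hh (Nat.zero_le _) rfl).bind ?_
  have key : ∀ u v w : List Bool, l r = w ++ u → l r' = w ++ v → ∃ j ≤ (l r).length,
      (loop (fun _ : Unit => regAct₂ r r' fun a b =>
      if a = b then if a = none then (.inr true, .left) else (.inl (), .right)
      else (.inr false, .left)) () : Frag α β ρ Bool).Exec x L
        (twoMem h l o r r' (w.length + 1)) (decide (u = v)) (twoMem h l o r r' j) := by
    intro u
    induction u with
    | nil =>
      intro v w hu hv
      have hw : w.length = (l r).length := by rw [hu]; simp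
      refine ⟨w.length, hw.le, Exec.loop_exit
        (exec_regAct₂ (mv := .left) hh (by omega) ?_)⟩
      rw [hu, hv]
      cases v <;> simp
    | cons b u ih =>
      intro v w hu hv
      have hw : w.length + u.length + 1 = (l r).length := by rw [hu]; simp; omega
      have hexit : ¬ some b = v.head? → ∃ j ≤ (l r).length,
          (loop (fun _ : Unit => regAct₂ r r' fun a b =>
          if a = b then if a = none then (.inr true, .left) else (.inl (), .right)
          else (.inr false, .left)) () : Frag α β ρ Bool).Exec x L
            (twoMem h l o r r' (w.length + 1)) false (twoMem h l o r r' j) := by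
        intro hne
        refine ⟨w.length, by omega, Exec.loop_exit
          (exec_regAct₂ (mv := .left) hh (by omega) ?_)⟩
        rw [hu, hv, if_neg]
        cases v
        · simp
        · simpa using hne
      cases v with
      | nil => simp at hexit ⊢; exact hexit
      | cons c v =>
        by_cases hbc : b = c
        · subst hbc
          obtain ⟨j, hj, he⟩ := ih v (w ++ [b]) (by simpa using hu) (by simpa using hv)
          refine ⟨j, hj, ?_⟩
          simp only [List.cons.injEq, true_and]
          refine Exec.loop_next (s' := ()) (exec_regAct₂ (mv := .right) hh (by omega) ?_)
            (by simpa [Move.apply] using he)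
          rw [hu, hv]
          simp
        · simpa [hbc] using hexit
  obtain ⟨j, hj, he⟩ := key _ _ [] rfl rfl
  refine he.bind ?_
  clear he
  generalize decide (l r = l r') = e
  induction j with
  | zero => exact Exec.loop_exit (exec_regAct₂ (mv := .stay) hh (Nat.zero_le _) rfl)
  | succ j ih =>
    refine Exec.loop_next (s' := ()) (exec_regAct₂ (mv := .left) hh (by omega) ?_)
      (ih (by omega))
    rw [if_neg (by simp; omega)]

end Frag

end Registers

end KTree

namespace KTree

/-! ### Loops over registers -/

section Loops

variable {α β ρ E S : Type} {x : List α} {L n : ℕ}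

/-- The number of symbols that satisfy `cnt`, before the first one that satisfies `ends`. -/
def countBefore (ends cnt : α → Bool) : List α → ℕ
  | [] => 0
  | a :: l => if ends a then 0 else (if cnt a then 1 else 0) + countBefore ends cnt l

theorem countBefore_le (ends cnt : α → Bool) (l : List α) :
    countBefore ends cnt l ≤ countBefore (fun _ => false) cnt l := by
  induction l with
  | nil => exact le_rfl
  | cons a l ih =>
    simp only [countBefore]
    split_ifs <;> simp_all

theorem countBefore_le_length (ends cnt : α → Bool) (l : List α) :
    countBefore ends cnt l ≤ l.length := by
  induction l with
  | nil => exact le_rfl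
  | cons a l ih =>
    simp only [countBefore, List.length_cons]
    split_ifs <;> omega

theorem readInput_append (u v : List α) :
    readInput (u ++ v) (u.length + 1) = match v with
      | [] => .rightEnd
      | a :: _ => .sym a := by
  cases v <;> simp [readInput]

namespace Frag

theorem exec_pure_store {h : ℕ} {σ : ρ → ℕ} {o : List β} (e : E) (hh : h ≤ x.length + 1) :
    (pure e : Frag α β ρ E).Exec x L (store h σ o) e (store h σ o) :=
  exec_pure e hh fun _ => Nat.zero_le _

variable [DecidableEq ρ]

/-- Add one to the register `r` modulo `N + 1`, where `N` is the number in `b`, and tell whether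
the result is zero. -/
def cyc (r b : ρ) : Frag α β ρ Bool :=
  (eq r b).bind fun e =>
    if e then (zero r).bind fun _ => pure true else (inc r).bind fun _ => pure false

theorem exec_cyc {h : ℕ} {σ : ρ → ℕ} {o : List β} {r b : ρ} (hh : h ≤ x.length + 1)
    (hL : ∀ m ≤ n, (bin m).length + 1 ≤ L) (hr : σ r ≤ n) (hb : σ b = n) :
    (cyc r b : Frag α β ρ Bool).Exec x L (store h σ o) (decide (σ r = n))
      (store h (Function.update σ r (if σ r = n then 0 else σ r + 1)) o) := by
  have h1 := exec_eq (x := x) (o := o) r b hh (hL _ hr)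
  rw [hb] at h1
  refine h1.bind ?_
  by_cases hrn : σ r = n
  · simp only [hrn, decide_true, if_true]
    exact (exec_zero r hh (hL _ hr)).bind (exec_pure_store _ hh)
  · simp only [hrn, decide_false, if_false, Bool.false_eq_true]
    exact (exec_inc r hh (hL _ hr)).bind (exec_pure_store _ hh)

/-- Run a fragment for all values `0, …, N` of the register `r`, where `N` is the number in `b`. -/
def forAll [Finite S] (r b : ρ) (body : S → Frag α β ρ S) : S → Frag α β ρ S :=
  loop fun s => (body s).bind fun s' => (cyc r b).bind fun e =>
    pure (if e then .inr s' else .inl s')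

/-- The sequences describe the memory before the `m`th of the `n + 1` rounds. The cyclic counter is
zero again at the end, so that loops can be nested. -/
theorem exec_forAll [Finite S] {r b : ρ} (hrb : b ≠ r) (hL : ∀ m ≤ n, (bin m).length + 1 ≤ L)
    {body : S → Frag α β ρ S} {h : ℕ → ℕ} {σ : ℕ → ρ → ℕ} {o : ℕ → List β} {s : ℕ → S}
    (hh : ∀ m, h m ≤ x.length + 1) (hσ : ∀ m, σ m b = n)
    (hbody : ∀ m ≤ n, (body (s m)).Exec x L (store (h m) (Function.update (σ m) r m) (o m))
      (s (m + 1)) (store (h (m + 1)) (Function.update (σ (m + 1)) r m) (o (m + 1)))) :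
    (forAll r b body (s 0)).Exec x L (store (h 0) (Function.update (σ 0) r 0) (o 0)) (s (n + 1))
      (store (h (n + 1)) (Function.update (σ (n + 1)) r 0) (o (n + 1))) := by
  have key : ∀ d m, m + d = n →
      (forAll r b body (s m)).Exec x L (store (h m) (Function.update (σ m) r m) (o m))
      (s (n + 1)) (store (h (n + 1)) (Function.update (σ (n + 1)) r 0) (o (n + 1))) := by
    intro d
    induction d with
    | zero =>
      intro m hm
      obtain rfl : m = n := hm
      have h1 := exec_cyc (x := x) (L := L) (n := m) (h := h (m + 1)) (o := o (m + 1)) (b := b)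
        (σ := Function.update (σ (m + 1)) r m) (r := r) (hh _) hL (by simp) (by simp [hrb, hσ])
      simp only [Function.update_self, decide_true, if_true, Function.update_idem] at h1
      exact Exec.loop_exit ((hbody m le_rfl).bind (h1.bind (exec_pure_store _ (hh _))))
    | succ d ih =>
      intro m hm
      have h1 := exec_cyc (x := x) (L := L) (n := n) (h := h (m + 1)) (o := o (m + 1)) (b := b)
        (σ := Function.update (σ (m + 1)) r m) (r := r) (hh _) hL (by simp; omega)
        (by simp [hrb, hσ])
      have hmn : m ≠ n := by omega
      simp only [Function.update_self, hmn, decide_false, if_false, Function.update_idem] at h1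
      exact Exec.loop_next ((hbody m (by omega)).bind (h1.bind (exec_pure_store _ (hh _))))
        (ih (m + 1) (by omega))
  exact key n 0 (Nat.zero_add n)

/-- Run a fragment as many times as the number in the register `b` says, using the counter `r`. -/
def times (r b : ρ) (body : Frag α β ρ Unit) : Frag α β ρ Unit :=
  (loop (fun _ : Unit => (eq r b).bind fun e =>
    if e then pure (.inr ()) else body.bind fun _ => (inc r).bind fun _ => pure (.inl ()))
    ()).bind fun _ => zero r

theorem exec_times {r b : ρ} (hrb : b ≠ r) {body : Frag α β ρ Unit} {h : ℕ → ℕ} {σ : ρ → ℕ}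
    {o : List β} (hL : ∀ m ≤ σ b, (bin m).length + 1 ≤ L) (hh : ∀ m, h m ≤ x.length + 1)
    (hbody : ∀ m < σ b, body.Exec x L (store (h m) (Function.update σ r m) o) ()
      (store (h (m + 1)) (Function.update σ r m) o)) :
    (times r b body).Exec x L (store (h 0) (Function.update σ r 0) o) ()
      (store (h (σ b)) (Function.update σ r 0) o) := by
  have key : ∀ d m, m + d = σ b →
      (loop (fun _ : Unit => (eq r b).bind fun e =>
        if e then pure (.inr ()) else body.bind fun _ => (inc r).bind fun _ => pure (.inl ()))
        ()).Exec x L (store (h m) (Function.update σ r m) o) ()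
      (store (h (σ b)) (Function.update σ r (σ b)) o) := by
    intro d
    induction d with
    | zero =>
      intro m hm
      have h1 := exec_eq (x := x) (L := L) (h := h m) (o := o)
        (σ := Function.update σ r m) r b (hh _) (by simpa using hL m (by omega))
      obtain rfl : m = σ b := hm
      simp only [Function.update_self, Function.update_of_ne hrb, decide_true] at h1
      exact Exec.loop_exit (h1.bind (exec_pure_store _ (hh _)))
    | succ d ih =>
      intro m hm
      have h1 := exec_eq (x := x) (L := L) (h := h m) (o := o)
        (σ := Function.update σ r m) r b (hh _) (by simpa using hL m (by omega))
      have hmb : m ≠ σ b := by omega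
      simp only [Function.update_self, Function.update_of_ne hrb, hmb, decide_false] at h1
      have h2 := exec_inc (x := x) (L := L) (h := h (m + 1)) (o := o)
        (σ := Function.update σ r m) r (hh _) (by simpa using hL m (by omega))
      simp only [Function.update_self, Function.update_idem] at h2
      refine Exec.loop_next (h1.bind ?_) (ih (m + 1) (by omega))
      exact (hbody m (by omega)).bind (h2.bind (exec_pure_store _ (hh _)))
  have h3 := exec_zero (x := x) (L := L) (h := h (σ b)) (o := o)
    (σ := Function.update σ r (σ b)) r (hh _) (by simpa using hL _ le_rfl)
  rw [Function.update_idem] at h3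
  exact (key (σ b) 0 (Nat.zero_add _)).bind h3

/-- Count the symbols of the input that satisfy `cnt`, before the first one that satisfies
`ends`. -/
def count (r : ρ) (ends cnt : α → Bool) : Frag α β ρ Unit :=
  (zero r).bind fun _ => right.bind fun _ =>
    (loop (fun _ : Unit => (inputAct fun s =>
      match s with
      | .sym a => if ends a then (none, .stay) else (some (cnt a), .right)
      | _ => (none, .stay)).bind fun e : Option Bool =>
        match e with
        | none => pure (.inr ())
        | some false => pure (.inl ())
        | some true => (inc r).bind fun _ => pure (.inl ())) ()).bind fun _ => leftEnd ()

theorem exec_count {σ : ρ → ℕ} {o : List β} {r : ρ} {ends cnt : α → Bool}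
    (hr : (bin (σ r)).length + 1 ≤ L)
    (hL : ∀ m ≤ countBefore ends cnt x, (bin m).length + 1 ≤ L) :
    (count r ends cnt : Frag α β ρ Unit).Exec x L (store 0 σ o) ()
      (store 0 (Function.update σ r (countBefore ends cnt x)) o) := by
  refine (exec_zero r (Nat.zero_le _) hr).bind (exec_right.bind ?_)
  have key : ∀ v u m, x = u ++ v → m + countBefore ends cnt v = countBefore ends cnt x →
      ∃ h ≤ x.length + 1, (loop (fun _ : Unit => (inputAct fun s =>
      match s with
      | .sym a => if ends a then (none, .stay) else (some (cnt a), .right)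
      | _ => (none, .stay)).bind fun e : Option Bool =>
        match e with
        | none => pure (.inr ())
        | some false => pure (.inl ())
        | some true => (inc r).bind fun _ => pure (.inl ())) () : Frag α β ρ Unit).Exec x L
          (store (u.length + 1) (Function.update σ r m) o) ()
          (store h (Function.update σ r (countBefore ends cnt x)) o) := by
    intro v
    induction v with
    | nil =>
      intro u m hx hm
      have hh : u.length + 1 ≤ x.length + 1 := by simp [hx]
      obtain rfl : m = countBefore ends cnt x := hm
      refine ⟨_, hh, Exec.loop_exit (Exec.bind (e := none) (exec_inputAct (mv := .stay)
        (fun _ => Nat.zero_le _) ?_) ?_)⟩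
      · rw [hx, readInput_append]
      · rw [Move.apply, min_eq_left hh]
        exact exec_pure_store _ hh
    | cons a v ih =>
      intro u m hx hm
      have hlen : x.length = u.length + v.length + 1 := by rw [hx]; simp; omega
      have hh : u.length + 1 ≤ x.length + 1 := by omega
      have hread : readInput x (u.length + 1) = .sym a := by rw [hx, readInput_append]
      by_cases hs : ends a
      · rw [countBefore, if_pos hs] at hm
        obtain rfl : m = countBefore ends cnt x := hm
        refine ⟨_, hh, Exec.loop_exit (Exec.bind (e := none) (exec_inputAct (mv := .stay)
          (fun _ => Nat.zero_le _) ?_) ?_)⟩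
        · rw [hread]; simp [hs]
        · rw [Move.apply, min_eq_left hh]
          exact exec_pure_store _ hh
      · rw [countBefore, if_neg hs] at hm
        obtain ⟨h, hh', he⟩ := ih (u ++ [a]) (m + if cnt a then 1 else 0) (by simp [hx])
          (by omega)
        rw [List.length_append, List.length_singleton] at he
        refine ⟨h, hh', Exec.loop_next (Exec.bind (e := some (cnt a))
          (exec_inputAct (mv := .right) (fun _ => Nat.zero_le _) ?_) ?_) he⟩
        · rw [hread]; simp [hs]
        · have hh2 : u.length + 1 + 1 ≤ x.length + 1 := by omega
          rw [Move.apply, min_eq_left hh2]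
          cases hc : cnt a
          · exact exec_pure_store _ hh2
          · rw [hc] at hm
            have h1 := exec_inc (x := x) (L := L) (h := u.length + 1 + 1) (o := o)
              (σ := Function.update σ r m) r hh2 (by simpa using hL m (by omega))
            simp only [Function.update_self, Function.update_idem] at h1
            exact h1.bind (exec_pure_store _ hh2)
  obtain ⟨h, hh, he⟩ := key x [] 0 rfl (Nat.zero_add _)
  have h1 : min (0 + 1) (x.length + 1) = ([] : List α).length + 1 := by simp
  rw [h1]
  exact he.bind (exec_leftEnd () hh)

/-- Read the input at position `v * (N + 1) + w + 2`, where `v`, `w`, and `N` are the numbers in the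
registers `rv`, `rw`, `b`, with the help of the registers `p` and `q`, and apply `g`. -/
def lookup (p q b rv rw : ρ) (g : InputSymbol α → Bool) : Frag α β ρ Bool :=
  (times p rv (forAll q b (fun _ => right) ())).bind fun _ =>
    (times q rw right).bind fun _ => right.bind fun _ => right.bind fun _ =>
      (inputAct fun s => (g s, .stay)).bind fun e => leftEnd e

/-- A row takes `n + 1` symbols, a colour and `n` matrix entries, which is the number of moves made
by the inner `forAll`. The last two moves account for the left end marker and the colour. The `min`
covers inputs that are too short. -/
theorem exec_lookup {p q b rv rw : ρ} {g : InputSymbol α → Bool} {σ : ρ → ℕ} {o : List β}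
    (hqb : b ≠ q) (hpv : rv ≠ p) (hqw : rw ≠ q) (hpq : p ≠ q) (hpb : b ≠ p)
    (hp : σ p = 0) (hq : σ q = 0)
    (hb : σ b = n) (hv : σ rv ≤ n) (hw : σ rw ≤ n) (hL : ∀ m ≤ n, (bin m).length + 1 ≤ L) :
    (lookup p q b rv rw g : Frag α β ρ Bool).Exec x L (store 0 σ o)
      (g (readInput x (min (σ rv * (n + 1) + σ rw + 2) (x.length + 1)))) (store 0 σ o) := by
  have hmin : ∀ h, min (min h (x.length + 1) + 1) (x.length + 1) = min (h + 1) (x.length + 1) :=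
    fun h => by omega
  have hpos : ∀ h, min h (x.length + 1) ≤ x.length + 1 := fun h => min_le_right _ _
  have hp0 : Function.update σ p 0 = σ := by rw [← hp, Function.update_eq_self]
  have hq0 : Function.update σ q 0 = σ := by rw [← hq, Function.update_eq_self]
  have h1 := exec_times (x := x) (L := L) (r := p) (b := rv) hpv
    (body := forAll q b (fun _ => right) ()) (h := fun m => min (m * (n + 1)) (x.length + 1))
    (σ := σ) (o := o) (fun m hm => hL m (hm.trans hv)) (fun m => hpos _) (by
      intro m _
      have h2 := exec_forAll (x := x) (L := L) (n := n) (S := Unit) hqb hL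
        (body := fun _ => right) (h := fun i => min (m * (n + 1) + i) (x.length + 1))
        (σ := fun _ => Function.update σ p m) (o := fun _ => o) (s := fun _ => ())
        (fun _ => hpos _) (fun _ => by simp [hpb, hb]) (by
          intro i _
          have h3 := exec_right (x := x) (L := L) (h := min (m * (n + 1) + i) (x.length + 1))
            (σ := Function.update (Function.update σ p m) q i) (o := o)
          rwa [hmin] at h3)
      rw [Function.update_comm hpq, hq0] at h2
      simpa [Nat.succ_mul] using h2)
  have h2 := exec_times (x := x) (L := L) (r := q) (b := rw) hqw
    (body := right) (h := fun m => min (σ rv * (n + 1) + m) (x.length + 1))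
    (σ := σ) (o := o) (fun m hm => hL m (hm.trans hw)) (fun m => hpos _) (by
      intro m _
      have h3 := exec_right (x := x) (L := L) (h := min (σ rv * (n + 1) + m) (x.length + 1))
        (σ := Function.update σ q m) (o := o)
      rwa [hmin] at h3)
  rw [hp0] at h1
  rw [hq0] at h2
  have h0 : min (0 * (n + 1)) (x.length + 1) = 0 := by simp
  simp only [h0] at h1
  refine h1.bind (h2.bind (exec_right.bind (exec_right.bind ?_)))
  have h5 : min (min (min (σ rv * (n + 1) + σ rw) (x.length + 1) + 1) (x.length + 1) + 1)
      (x.length + 1) = min (σ rv * (n + 1) + σ rw + 2) (x.length + 1) := by omega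
  rw [h5]
  refine (exec_inputAct (mv := .stay) (fun _ => Nat.zero_le _) rfl).bind ?_
  exact exec_leftEnd _ (by omega)

end Frag

end Loops

end KTree

namespace KTree

/-! ### The tour -/

section Tour

variable {k n : ℕ}

/-- One step of the tour. In a state `(a, i)`, all `a j` with `j ≠ i` form a `k`-clique, and `a i`
runs in cyclic order through the candidates for a further vertex; whenever a `(k + 1)`-clique has
been found, the tour goes on with the next index. -/
def tourStep (good : (Fin (k + 1) → Fin (n + 1)) → Fin (k + 1) → Bool)
    (s : (Fin (k + 1) → Fin (n + 1)) × Fin (k + 1)) :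
    (Fin (k + 1) → Fin (n + 1)) × Fin (k + 1) :=
  let i := if good s.1 s.2 then s.2 + 1 else s.2
  (Function.update s.1 i (s.1 i + 1), i)

/-- A step of the tour that also records the colour of `v`. -/
def searchStep (good : (Fin (k + 1) → Fin (n + 1)) → Fin (k + 1) → Bool) (v : ℕ)
    (s : ((Fin (k + 1) → Fin (n + 1)) × Fin (k + 1)) × Option (Fin (k + 1))) :
    ((Fin (k + 1) → Fin (n + 1)) × Fin (k + 1)) × Option (Fin (k + 1)) :=
  (tourStep good s.1,
    if good s.1.1 s.1.2 = true ∧ (s.1.1 s.1.2).val = v then some s.1.2 else s.2)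

/-- The alphabet of the input words. -/
abbrev InputAlphabet (k : ℕ) : Type := Bool ⊕ Option (Fin (k + 1))

/-- The scanned symbol is a positive entry of the adjacency matrix. -/
def isEdge : InputSymbol (InputAlphabet k) → Bool
  | .sym (.inl b) => b
  | _ => false

/-- The entry of the adjacency matrix at `(v, w)` as read by the machine. -/
def adjAt (x : List (InputAlphabet k)) (n v w : ℕ) : Bool :=
  isEdge (readInput x (min (v * (n + 1) + w + 2) (x.length + 1)))

/-- The test of the machine whether `a i` is adjacent to all other `a j`. -/
def goodAt (x : List (InputAlphabet k)) (a : Fin (k + 1) → Fin (n + 1)) (i : Fin (k + 1)) : Bool :=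
  !decide ((a i).val = n) &&
    ((List.finRange (k + 1)).filter (· ≠ i)).all fun j => adjAt x n (a i) (a j)

/-- The number of vertices as counted by the machine. -/
def vertexCount (x : List (InputAlphabet k)) : ℕ := countBefore (fun _ => false) Sum.isRight x

theorem startVertex_lt (x : List (InputAlphabet k)) (i : Fin (k + 1)) :
    countBefore (fun s => decide (s = .inr (some i))) Sum.isRight x < vertexCount x + 1 :=
  Nat.lt_succ_of_le (countBefore_le _ _ _)

/-- The tuple of vertices of the root with their colours as indices; the index of a missing colour
gets the number of vertices. -/
def startTuple (x : List (InputAlphabet k)) (i : Fin (k + 1)) : Fin (vertexCount x + 1) :=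
  ⟨_, startVertex_lt x i⟩

/-- The first missing colour, or `0`. -/
def startIndex (x : List (InputAlphabet k)) : Fin (k + 1) :=
  ((List.finRange (k + 1)).find? fun i => decide ((startTuple x i).val = vertexCount x)).getD 0

/-- The colour of `v` found on the tour. -/
def searchColor (x : List (InputAlphabet k)) (v : ℕ) : Option (Fin (k + 1)) :=
  ((searchStep (goodAt x) v)^[(vertexCount x + 1) ^ (k + 2)]
    ((startTuple x, startIndex x), none)).2

/-- The function computed by the machine. -/
def colorWord (x : List (InputAlphabet k)) : List (Fin (k + 1)) :=
  (List.range (vertexCount x + 1)).flatMap fun v => (searchColor x v).toList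

/-- The registers: four single ones, the tuple of vertices, and the counters. -/
abbrev Reg (k : ℕ) : Type := Fin 4 ⊕ Fin (k + 1) ⊕ Fin (k + 2)

namespace Reg

/-- The register with the number of vertices. -/
abbrev size : Reg k := .inl 0
/-- The register with the vertex whose colour is searched. -/
abbrev vert : Reg k := .inl 1
/-- The registers of the tuple. -/
abbrev tup (i : Fin (k + 1)) : Reg k := .inr (.inl i)
/-- The counters. -/
abbrev ctr (j : Fin (k + 2)) : Reg k := .inr (.inr j)

end Reg

/-- The contents of the registers. -/
def regs (n v : ℕ) (a : Fin (k + 1) → ℕ) (t : Fin (k + 2) → ℕ) : Reg k → ℕ :=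
  Sum.elim ![n, v, 0, 0] (Sum.elim a t)

theorem regs_size (n v : ℕ) (a : Fin (k + 1) → ℕ) (t : Fin (k + 2) → ℕ) :
    regs n v a t Reg.size = n := rfl

theorem regs_vert (n v : ℕ) (a : Fin (k + 1) → ℕ) (t : Fin (k + 2) → ℕ) :
    regs n v a t Reg.vert = v := rfl

theorem regs_tup (n v : ℕ) (a : Fin (k + 1) → ℕ) (t : Fin (k + 2) → ℕ) (i : Fin (k + 1)) :
    regs n v a t (Reg.tup i) = a i := rfl

theorem update_regs_size (n v m : ℕ) (a : Fin (k + 1) → ℕ) (t : Fin (k + 2) → ℕ) :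
    Function.update (regs n v a t) Reg.size m = regs m v a t := by
  funext i
  rcases i with i | i | i
  · fin_cases i <;> simp [regs]
  · simp [regs]
  · simp [regs]

theorem update_regs_vert (n v m : ℕ) (a : Fin (k + 1) → ℕ) (t : Fin (k + 2) → ℕ) :
    Function.update (regs n v a t) Reg.vert m = regs n m a t := by
  funext i
  rcases i with i | i | i
  · fin_cases i <;> simp [regs]
  · simp [regs]
  · simp [regs]

theorem update_regs_tup (n v m : ℕ) (a : Fin (k + 1) → ℕ) (t : Fin (k + 2) → ℕ) (i) :
    Function.update (regs n v a t) (Reg.tup i) m = regs n v (Function.update a i m) t := by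
  simp only [regs, Sum.update_elim_inr, Sum.update_elim_inl]

theorem update_regs_ctr (n v m : ℕ) (a : Fin (k + 1) → ℕ) (t : Fin (k + 2) → ℕ) (i) :
    Function.update (regs n v a t) (Reg.ctr i) m = regs n v a (Function.update t i m) := by
  simp only [regs, Sum.update_elim_inr]

/-! ### The program -/

section Program

open Frag

variable {x : List (InputAlphabet k)} {L : ℕ}

/-- Fragments for this problem. -/
abbrev Prog (k : ℕ) (E : Type) : Type 1 := Frag (InputAlphabet k) (Fin (k + 1)) (Reg k) E

/-- The test of the adjacency of `a i` with `a j` for all `j` in a list. -/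
def allAdjProg (i : Fin (k + 1)) : List (Fin (k + 1)) → Prog k Bool
  | [] => pure true
  | j :: l => (lookup (.inl 2) (.inl 3) .size (.tup i) (.tup j) isEdge).bind fun e =>
      if e then allAdjProg i l else pure false

theorem exec_allAdjProg (hL : ∀ m ≤ n, (bin m).length + 1 ≤ L) {v : ℕ}
    (a : Fin (k + 1) → Fin (n + 1)) (t : Fin (k + 2) → ℕ) (o : List (Fin (k + 1)))
    (i : Fin (k + 1)) (l : List (Fin (k + 1))) :
    (allAdjProg i l).Exec x L (store 0 (regs n v (fun i => a i) t) o)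
      (l.all fun j => adjAt x n (a i) (a j)) (store 0 (regs n v (fun i => a i) t) o) := by
  induction l with
  | nil => exact exec_pure_store _ (Nat.zero_le _)
  | cons j l ih =>
    have h1 := exec_lookup (x := x) (L := L) (n := n) (p := (.inl 2 : Reg k)) (q := .inl 3)
      (b := Reg.size) (rv := Reg.tup i) (rw := Reg.tup j) (g := isEdge)
      (σ := regs n v (fun i => a i) t) (o := o) (by simp) (by simp) (by simp) (by simp) (by simp)
      rfl rfl rfl (Nat.lt_succ_iff.1 (a i).2) (Nat.lt_succ_iff.1 (a j).2) hL
    refine h1.bind ?_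
    change Exec (if adjAt x n (a i) (a j) = true then _ else _) _ _ _ _ _
    by_cases h : adjAt x n (a i) (a j) = true
    · simpa [h] using ih
    · simp only [h, List.all_cons, Bool.false_and]
      exact exec_pure_store _ (Nat.zero_le _)

theorem exec_eqTuple (hL : ∀ m ≤ n, (bin m).length + 1 ≤ L) {v : ℕ}
    (a : Fin (k + 1) → Fin (n + 1)) (t : Fin (k + 2) → ℕ) (o : List (Fin (k + 1)))
    (i : Fin (k + 1)) (r : Reg k) :
    (eq (.tup i) r : Prog k Bool).Exec x L (store 0 (regs n v (fun i => a i) t) o)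
      (decide ((a i).val = regs n v (fun i => a i) t r))
      (store 0 (regs n v (fun i => a i) t) o) := by
  have h1 := exec_eq (x := x) (L := L) (h := 0) (σ := regs n v (fun i => a i) t) (o := o)
    (Reg.tup i) r (Nat.zero_le _) (hL _ (Nat.lt_succ_iff.1 (a i).2))
  rwa [regs_tup] at h1

/-- The program for `goodAt`. -/
def goodProg (i : Fin (k + 1)) : Prog k Bool :=
  (eq (.tup i) .size).bind fun e =>
    if e then pure false else allAdjProg i ((List.finRange (k + 1)).filter (· ≠ i))

theorem exec_goodProg (hL : ∀ m ≤ n, (bin m).length + 1 ≤ L) {v : ℕ}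
    (a : Fin (k + 1) → Fin (n + 1)) (t : Fin (k + 2) → ℕ) (o : List (Fin (k + 1)))
    (i : Fin (k + 1)) :
    (goodProg i).Exec x L (store 0 (regs n v (fun i => a i) t) o)
      (goodAt x a i) (store 0 (regs n v (fun i => a i) t) o) := by
  have h1 := exec_eqTuple (x := x) (v := v) hL a t o i Reg.size
  rw [regs_size] at h1
  refine h1.bind ?_
  by_cases h : (a i).val = n
  · simp only [h, decide_true, if_true, goodAt, Bool.not_true, Bool.false_and]
    exact exec_pure_store _ (Nat.zero_le _)
  · simp only [h, decide_false, Bool.false_eq_true, if_false, goodAt, Bool.not_false,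
      Bool.true_and]
    exact exec_allAdjProg hL a t o i _

/-- The program for `searchStep`. -/
def stepProg (s : Fin (k + 1) × Option (Fin (k + 1))) :
    Prog k (Fin (k + 1) × Option (Fin (k + 1))) :=
  (goodProg s.1).bind fun e => (eq (.tup s.1) .vert).bind fun e' =>
    (cyc (.tup (if e then s.1 + 1 else s.1)) .size).bind fun _ =>
      pure (if e then s.1 + 1 else s.1, if e = true ∧ e' = true then some s.1 else s.2)

theorem val_update_add_one (a : Fin (k + 1) → Fin (n + 1)) (i : Fin (k + 1)) :
    (fun j => (Function.update a i (a i + 1) j).val) =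
      Function.update (fun j => (a j).val) i (if (a i).val = n then 0 else (a i).val + 1) := by
  funext j
  by_cases hj : j = i
  · subst hj
    simp [Fin.val_add_one, Fin.ext_iff]
  · simp [hj]

/-- The index and the colour found so far are kept in the finite control, the tuple in the
registers. -/
theorem exec_stepProg (hL : ∀ m ≤ n, (bin m).length + 1 ≤ L) {v : ℕ}
    (t : Fin (k + 2) → ℕ) (o : List (Fin (k + 1)))
    (s : ((Fin (k + 1) → Fin (n + 1)) × Fin (k + 1)) × Option (Fin (k + 1))) :
    (stepProg (s.1.2, s.2)).Exec x L (store 0 (regs n v (fun i => s.1.1 i) t) o)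
      ((searchStep (goodAt x) v s).1.2, (searchStep (goodAt x) v s).2)
      (store 0 (regs n v (fun i => (searchStep (goodAt x) v s).1.1 i) t) o) := by
  obtain ⟨⟨a, i⟩, f⟩ := s
  have h0 := exec_eqTuple (x := x) (v := v) hL a t o i Reg.vert
  rw [regs_vert] at h0
  refine (exec_goodProg hL a t o i).bind (h0.bind ?_)
  have h1 := exec_cyc (x := x) (L := L) (n := n) (o := o) (h := 0)
    (r := .tup (if goodAt x a i then i + 1 else i)) (b := .size)
    (σ := regs n v (fun i => a i) t) (Nat.zero_le _) hL (Nat.lt_succ_iff.1 (a _).2) rfl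
  rw [update_regs_tup] at h1
  refine h1.bind ?_
  have h2 := val_update_add_one a (if goodAt x a i then i + 1 else i)
  simp only [searchStep, tourStep]
  rw [h2]
  simp only [decide_eq_true_eq]
  exact exec_pure_store _ (Nat.zero_le _)

/-- Nested loops: with `j` loops, the body is repeated `(N + 1) ^ j` times. -/
def nestProg {S : Type} [Finite S] (body : S → Prog k S) : (j : ℕ) → j ≤ k + 2 → S → Prog k S
  | 0, _ => body
  | j + 1, hj => forAll (.ctr ⟨j, hj⟩) .size (nestProg body j (by omega))

/-- A state in `A` is split into the part `st` in the finite control and the part `tp` on the tapes.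
The counters of the inner loops start at zero and return to it. -/
theorem exec_nestProg {S A : Type} [Finite S] (hL : ∀ m ≤ n, (bin m).length + 1 ≤ L) {v : ℕ}
    {o : List (Fin (k + 1))} (body : S → Prog k S) (st : A → S) (tp : A → Fin (k + 1) → ℕ)
    (g : A → A) (hbody : ∀ t s, (body (st s)).Exec x L (store 0 (regs n v (tp s) t) o) (st (g s))
      (store 0 (regs n v (tp (g s)) t) o)) (j : ℕ) (hj : j ≤ k + 2) (t : Fin (k + 2) → ℕ)
    (ht : ∀ i, i.val < j → t i = 0) (s : A) :
    (nestProg body j hj (st s)).Exec x L (store 0 (regs n v (tp s) t) o)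
      (st (g^[(n + 1) ^ j] s)) (store 0 (regs n v (tp (g^[(n + 1) ^ j] s)) t) o) := by
  induction j generalizing t s with
  | zero => rw [pow_zero]; exact hbody t s
  | succ j ih =>
    have h1 := exec_forAll (x := x) (L := L) (n := n) (r := (.ctr ⟨j, hj⟩ : Reg k)) (b := .size)
      (by simp) hL (body := nestProg body j (by omega)) (h := fun _ => 0)
      (σ := fun m => regs n v (tp ((g^[(n + 1) ^ j])^[m] s)) t) (o := fun _ => o)
      (s := fun m => st ((g^[(n + 1) ^ j])^[m] s)) (fun _ => Nat.zero_le _) (fun _ => rfl) (by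
        intro m _
        rw [update_regs_ctr, update_regs_ctr, Function.iterate_succ_apply']
        refine ih (by omega) _ ?_ _
        intro i hi
        rw [Function.update_of_ne (by rintro rfl; exact lt_irrefl _ hi)]
        exact ht i (by omega))
    have h2 : Function.update t ⟨j, hj⟩ 0 = t := by
      rw [← ht ⟨j, hj⟩ (Nat.lt_succ_self j), Function.update_eq_self]
    rw [update_regs_ctr, update_regs_ctr, h2] at h1
    rw [pow_succ, Function.iterate_mul]
    exact h1

/-- The program that fills the tuple. -/
def startProg : List (Fin (k + 1)) → Prog k Unit
  | [] => pure ()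
  | i :: l => (count (.tup i) (fun s => decide (s = .inr (some i))) Sum.isRight).bind fun _ =>
      startProg l

/-- Registers in `l` may still hold leftovers of an earlier search, so only a bound on their
contents is assumed. -/
theorem exec_startProg (hL : ∀ m ≤ vertexCount x, (bin m).length + 1 ≤ L) {v : ℕ}
    (t : Fin (k + 2) → ℕ) (o : List (Fin (k + 1))) (l : List (Fin (k + 1)))
    (a : Fin (k + 1) → ℕ) (ha : ∀ i, a i ≤ vertexCount x) (hl : ∀ i, i ∉ l → a i = startTuple x i) :
    (startProg l).Exec x L (store 0 (regs (vertexCount x) v a t) o) ()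
      (store 0 (regs (vertexCount x) v (fun i => startTuple x i) t) o) := by
  induction l generalizing a with
  | nil =>
    obtain rfl : a = fun i => (startTuple x i).val := funext fun i => hl i List.not_mem_nil
    exact exec_pure_store _ (Nat.zero_le _)
  | cons i l ih =>
    have h1 := exec_count (x := x) (L := L) (σ := regs (vertexCount x) v a t) (o := o)
      (r := Reg.tup i) (ends := fun s => decide (s = .inr (some i))) (cnt := Sum.isRight)
      (hL _ (ha i)) fun m hm => hL m (hm.trans (countBefore_le _ _ _))
    rw [update_regs_tup] at h1
    refine h1.bind (ih _ (fun j => ?_) fun j hj => ?_)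
    · by_cases hji : j = i
      · subst hji; rw [Function.update_self]; exact countBefore_le _ _ _
      · simpa [hji] using ha j
    · by_cases hji : j = i
      · subst hji; simp [startTuple]
      · simpa [hji] using hl j (by simp [hji, hj])

/-- The program that finds the first index whose vertex is missing. -/
def indexProg : List (Fin (k + 1)) → Prog k (Fin (k + 1))
  | [] => pure 0
  | i :: l => (eq (.tup i) .size).bind fun e => if e then pure i else indexProg l

theorem exec_indexProg (hL : ∀ m ≤ n, (bin m).length + 1 ≤ L) {v : ℕ}
    (a : Fin (k + 1) → Fin (n + 1)) (t : Fin (k + 2) → ℕ) (o : List (Fin (k + 1)))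
    (l : List (Fin (k + 1))) :
    (indexProg l).Exec x L (store 0 (regs n v (fun i => a i) t) o)
      ((l.find? fun i => decide ((a i).val = n)).getD 0)
      (store 0 (regs n v (fun i => a i) t) o) := by
  induction l with
  | nil => exact exec_pure_store _ (Nat.zero_le _)
  | cons i l ih =>
    have h1 := exec_eqTuple (x := x) (v := v) hL a t o i Reg.size
    rw [regs_size] at h1
    refine h1.bind ?_
    by_cases h : (a i).val = n
    · simp only [h, decide_true, if_true, List.find?_cons_of_pos, Option.getD_some]
      exact exec_pure_store _ (Nat.zero_le _)
    · simpa [h] using ih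

/-- The search for the colour of one vertex. -/
def searchProg : Prog k Unit :=
  (startProg (List.finRange (k + 1))).bind fun _ =>
    (indexProg (List.finRange (k + 1))).bind fun i =>
      (nestProg stepProg (k + 2) le_rfl (i, none)).bind fun s => emit s.2

theorem exec_searchProg (hL : ∀ m ≤ vertexCount x, (bin m).length + 1 ≤ L) {v : ℕ}
    (o : List (Fin (k + 1))) (a : Fin (k + 1) → ℕ) (ha : ∀ i, a i ≤ vertexCount x) :
    ∃ a' : Fin (k + 1) → ℕ, (∀ i, a' i ≤ vertexCount x) ∧
    searchProg.Exec x L (store 0 (regs (vertexCount x) v a fun _ => 0) o) ()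
      (store 0 (regs (vertexCount x) v a' fun _ => 0) (o ++ (searchColor x v).toList)) := by
  have h := exec_nestProg hL stepProg
    (fun s : ((Fin (k + 1) → Fin (vertexCount x + 1)) × Fin (k + 1)) × Option (Fin (k + 1)) =>
      (s.1.2, s.2)) (fun s i => s.1.1 i) (searchStep (goodAt x) v)
    (fun t s => exec_stepProg (x := x) hL t o s) (k + 2) le_rfl (fun _ => 0)
    (fun _ _ => rfl) ((startTuple x, startIndex x), none)
  exact ⟨_, fun i => Nat.lt_succ_iff.1 (Fin.is_lt _),
    (exec_startProg hL _ o _ a ha fun i hi => absurd (List.mem_finRange i) hi).bind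
    ((exec_indexProg hL _ _ o _).bind (h.bind (exec_emit _ (Nat.zero_le _)
      fun _ => Nat.zero_le _)))⟩

/-- The whole program. -/
def mainProg : Prog k Unit :=
  (count .size (fun _ => false) Sum.isRight).bind fun _ =>
    forAll .vert .size (fun _ : Unit => searchProg) ()

theorem exec_mainProg (hL : ∀ m ≤ vertexCount x, (bin m).length + 1 ≤ L) :
    ∃ a : Fin (k + 1) → ℕ, mainProg.Exec x L (store 0 (regs 0 0 (fun _ => 0) fun _ => 0) []) ()
      (store 0 (regs (vertexCount x) 0 a fun _ => 0) (colorWord x)) := by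
  have h1 := exec_count (x := x) (L := L) (σ := regs 0 0 (fun _ : Fin (k + 1) => 0) fun _ => 0)
    (o := ([] : List (Fin (k + 1)))) (r := Reg.size) (ends := fun _ => false)
    (cnt := Sum.isRight) (hL 0 (Nat.zero_le _)) hL
  rw [update_regs_size] at h1
  -- Each search starts with whatever tuple the one before has left; `A` strings these tuples
  -- together.
  choose f hf hexec using fun (v : ℕ) (o : List (Fin (k + 1)))
    (a : {a : Fin (k + 1) → ℕ // ∀ i, a i ≤ vertexCount x}) =>
      exec_searchProg (x := x) hL (v := v) o a.1 a.2
  let o : ℕ → List (Fin (k + 1)) := fun v => (List.range v).flatMap fun v =>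
    (searchColor x v).toList
  let A : ℕ → {a : Fin (k + 1) → ℕ // ∀ i, a i ≤ vertexCount x} := fun v =>
    Nat.rec ⟨fun _ => 0, fun _ => Nat.zero_le _⟩ (fun v a => ⟨f v (o v) a, hf v (o v) a⟩) v
  have h2 := exec_forAll (x := x) (L := L) (n := vertexCount x) (r := (.vert : Reg k))
    (b := .size) (by simp) hL (body := fun _ : Unit => searchProg) (h := fun _ => 0)
    (σ := fun v => regs (vertexCount x) 0 (A v).1 fun _ => 0) (o := o) (s := fun _ => ())
    (fun _ => Nat.zero_le _) (fun _ => rfl) (by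
      intro v _
      rw [update_regs_vert, update_regs_vert]
      have := hexec v (o v) (A v)
      have ho : o (v + 1) = o v ++ (searchColor x v).toList := by
        simp [o, List.range_succ]
      rw [ho]
      exact this)
  rw [update_regs_vert, update_regs_vert] at h2
  exact ⟨_, h1.bind h2⟩

theorem logspaceComputable_colorWord : LogspaceComputable (colorWord (k := k)) := by
  -- All registers stay at most `vertexCount x`, hence at most the input length. The factor `2`
  -- makes room for a word of length `log + 1` and one more cell.
  refine logspaceComputable_of_frag mainProg colorWord 2 fun x => ?_
  obtain ⟨a, ha⟩ := exec_mainProg (x := x) (L := 2 * (Nat.log 2 x.length + 1)) fun m hm => by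
    have := length_bin_mono (hm.trans (countBefore_le_length _ _ _))
    omega
  have hinit : (Mem.init : Mem (Fin (k + 1)) (Reg k)) =
      store 0 (regs 0 0 (fun _ => 0) fun _ => 0) [] := by
    simp only [Mem.init, store, regMem, Mem.mk.injEq, and_true, true_and]
    funext i p
    have : regs 0 0 (fun _ : Fin (k + 1) => 0) (fun _ => 0) i = 0 := by
      rcases i with i | i | i
      · fin_cases i <;> rfl
      · rfl
      · rfl
    rw [this]
    cases p <;> rfl
  rw [hinit]
  exact ⟨_, _, ha, fun _ => rfl, rfl⟩

end Program

end Tour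

end KTree

namespace KTree

/-! ### The tour visits all cliques -/

section Rainbow

open scoped Classical

variable {V : Type*} {k : ℕ} {G : SimpleGraph V}

/-- The `(k + 1)`-cliques, with their vertices indexed by their colours. -/
structure Rainbow (C : G.Coloring (Fin (k + 1))) (b : Fin (k + 1) → V) : Prop where
  color : ∀ i, C (b i) = i
  adj : ∀ i j, i ≠ j → G.Adj (b i) (b j)

variable {C : G.Coloring (Fin (k + 1))} {b b' : Fin (k + 1) → V}

theorem Rainbow.injective (h : Rainbow C b) : Function.Injective b := fun i j hij => by
  rw [← h.color i, hij, h.color]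

theorem Rainbow.isNClique_image (h : Rainbow C b) (s : Finset (Fin (k + 1))) :
    G.IsNClique s.card (s.image b) := by
  refine ⟨?_, Finset.card_image_of_injective _ h.injective⟩
  intro x hx y hy hxy
  obtain ⟨i, -, rfl⟩ := Finset.mem_image.1 hx
  obtain ⟨j, -, rfl⟩ := Finset.mem_image.1 hy
  exact h.adj i j fun hij => hxy (by rw [hij])

theorem Rainbow.isNClique_univ (h : Rainbow C b) :
    G.IsNClique (k + 1) (Finset.univ.image b) := by
  simpa using h.isNClique_image Finset.univ

theorem Rainbow.isNClique_erase (h : Rainbow C b) (j : Fin (k + 1)) :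
    G.IsNClique k ((Finset.univ.erase j).image b) := by
  simpa using h.isNClique_image (Finset.univ.erase j)

/-- The node of the decomposition tree given by a rainbow tuple. -/
noncomputable def Rainbow.node (h : Rainbow C b) : Node k G := ⟨Finset.univ.image b, .inl h.isNClique_univ⟩

theorem Rainbow.card_node (h : Rainbow C b) : h.node.1.card = k + 1 := h.isNClique_univ.2

theorem Rainbow.mem_node (h : Rainbow C b) (i : Fin (k + 1)) : b i ∈ h.node.1 :=
  Finset.mem_image_of_mem b (Finset.mem_univ i)

theorem Rainbow.eq_of_mem_node (h : Rainbow C b) {v : V} (hv : v ∈ h.node.1) : b (C v) = v := by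
  obtain ⟨i, -, rfl⟩ := Finset.mem_image.1 hv
  rw [h.color]

theorem Rainbow.eq_of_node_eq (h : Rainbow C b) (h' : Rainbow C b') (heq : h.node = h'.node) :
    b = b' := by
  funext i
  have h1 := h'.mem_node i
  rw [← heq] at h1
  have h2 := h.eq_of_mem_node h1
  rwa [h'.color] at h2

/-- A clique with `k + 1` vertices uses all `k + 1` colours. -/
theorem exists_rainbow (C : G.Coloring (Fin (k + 1))) {M : Node k G} (hM : M.1.card = k + 1) :
    ∃ (b : Fin (k + 1) → V) (h : Rainbow C b), h.node = M := by
  have hc := Node.isNClique_of_card hM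
  have himg : M.1.image C = Finset.univ := by
    rw [← Finset.card_eq_iff_eq_univ, Finset.card_image_of_injOn (coloring_injOn C hc), hM,
      Fintype.card_fin]
  have hex : ∀ i, ∃ v ∈ M.1, C v = i := fun i => by
    have := Finset.mem_univ i
    rwa [← himg, Finset.mem_image] at this
  choose b hb hbC using hex
  have h : Rainbow C b := ⟨hbC, fun i j hij => hc.1 (hb i) (hb j) fun heq => hij (by
    rw [← hbC i, heq, hbC])⟩
  refine ⟨b, h, Subtype.ext (Finset.eq_of_subset_of_card_le ?_ (by rw [hM, h.card_node]))⟩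
  intro v hv
  obtain ⟨i, -, rfl⟩ := Finset.mem_image.1 hv
  exact hb i

/-- The `k`-clique that two rainbow tuples have in common if they differ in one place. -/
noncomputable def Rainbow.common (h : Rainbow C b) (h' : Rainbow C b') {j : Fin (k + 1)} (hne : b ≠ b')
    (hbb : ∀ l, l ≠ j → b l = b' l) : Node k G :=
  ⟨(Finset.univ.erase j).image b, .inr ⟨h.isNClique_erase j, h.node.1, h'.node.1,
    fun heq => hne (h.eq_of_node_eq h' (Subtype.ext heq)), h.isNClique_univ, h'.isNClique_univ,
    Finset.image_subset_image (Finset.subset_univ _), by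
      intro v hv
      obtain ⟨l, hl, rfl⟩ := Finset.mem_image.1 hv
      rw [hbb l (Finset.ne_of_mem_erase hl)]
      exact h'.mem_node l⟩⟩

theorem Rainbow.card_common (h : Rainbow C b) (h' : Rainbow C b') {j : Fin (k + 1)}
    (hne : b ≠ b') (hbb : ∀ l, l ≠ j → b l = b' l) : (h.common h' hne hbb).1.card = k :=
  (h.isNClique_erase j).2

theorem Rainbow.common_adj_left (h : Rainbow C b) (h' : Rainbow C b') {j : Fin (k + 1)}
    (hne : b ≠ b') (hbb : ∀ l, l ≠ j → b l = b' l) :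
    (decompTree k G).Adj (h.common h' hne hbb) h.node :=
  .inl ⟨h.card_common h' hne hbb, h.card_node, Finset.image_subset_image (Finset.subset_univ _)⟩

theorem Rainbow.common_adj_right (h : Rainbow C b) (h' : Rainbow C b') {j : Fin (k + 1)}
    (hne : b ≠ b') (hbb : ∀ l, l ≠ j → b l = b' l) :
    (decompTree k G).Adj (h.common h' hne hbb) h'.node := by
  refine .inl ⟨h.card_common h' hne hbb, h'.card_node, ?_⟩
  intro v hv
  obtain ⟨l, hl, rfl⟩ := Finset.mem_image.1 hv
  rw [hbb l (Finset.ne_of_mem_erase hl)]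
  exact h'.mem_node l

theorem Node.ne_of_card {M N : Node k G} (hM : M.1.card = k) (hN : N.1.card = k + 1) : M ≠ N := by
  rintro rfl
  omega

/-- The cliques beyond the `k`-clique `M \ M j`, as seen from the `(k + 1)`-clique `M`. -/
theorem exists_side (hT : (decompTree k G).IsAcyclic) {M : Fin (k + 1) → V} (hM : Rainbow C M)
    (j : Fin (k + 1)) : ∃ S : Set (Fin (k + 1) → V), M ∉ S ∧
      (∀ b, Rainbow C b → (∀ l, l ≠ j → b l = M l) → b ≠ M → b ∈ S) ∧
      (∀ b ∈ S, Rainbow C b → ∀ b', Rainbow C b' → ∀ l, (∀ i, i ≠ l → b i = b' i) →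
        b' ∈ S ∨ (b' = M ∧ l = j)) := by
  -- If no other `(k+1)`-clique contains `M` without `M j`, nothing lies beyond, and `S` is empty.
  by_cases hex : ∃ b₀, ∃ _ : Rainbow C b₀, (∀ l, l ≠ j → M l = b₀ l) ∧ M ≠ b₀
  · obtain ⟨b₀, hb₀, hbM, hne⟩ := hex
    set K := hM.common hb₀ hne hbM with hK
    have hKc : K.1.card = k := hM.card_common hb₀ hne hbM
    have hKM : (decompTree k G).Adj K hM.node := hM.common_adj_left hb₀ hne hbM
    have hbr := SimpleGraph.isAcyclic_iff_forall_adj_isBridge.1 hT hKM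
    rw [SimpleGraph.isBridge_iff] at hbr
    have hadj : ∀ A B : Node k G, (decompTree k G).Adj A B → A.1.card = k → B.1.card = k + 1 →
        ¬ (A = K ∧ B = hM.node) →
        ((decompTree k G).deleteEdges {s(K, hM.node)}).Adj A B := by
      intro A B hAB hA hB hn
      rw [SimpleGraph.deleteEdges_adj]
      refine ⟨hAB, fun h => ?_⟩
      rw [Set.mem_singleton_iff, Sym2.eq_iff] at h
      rcases h with h | h
      · exact hn h
      · exact Node.ne_of_card hA hM.card_node h.1
    have hM1 : ¬ ((decompTree k G).deleteEdges {s(K, hM.node)}).Reachable K hM.node := hbr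
    -- `S` is the component of `K` after removal of the bridge between `K` and `M`.
    refine ⟨{b | ∃ h : Rainbow C b,
      ((decompTree k G).deleteEdges {s(K, hM.node)}).Reachable K h.node}, ?_, ?_, ?_⟩
    · rintro ⟨_, h2⟩
      exact hM1 h2
    · intro b hb hbM' hne'
      refine ⟨hb, (hadj _ _ ?_ hKc hb.card_node fun h => hne' (hb.eq_of_node_eq hM h.2)).reachable⟩
      -- The underlying set depends on `M` and `j` only; the second tuple just certifies that it is
      -- a node.
      have h1 : K = hM.common hb (Ne.symm hne') fun l hl => (hbM' l hl).symm := rfl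
      rw [h1]
      exact hM.common_adj_right _ _ _
    · rintro b ⟨hb, hbr'⟩ - b' hb' l hl
      by_cases hbb : b = b'
      · subst hbb; exact .inl ⟨hb, hbr'⟩
      · set K' := hb.common hb' hbb hl with hK'
        have hKc' : K'.1.card = k := hb.card_common hb' hbb hl
        have hbM' : b ≠ M := by
          rintro rfl
          exact hM1 hbr'
        have h1 := hadj K' hb.node (hb.common_adj_left hb' hbb hl) hKc' hb.card_node
          fun h => hbM' (hb.eq_of_node_eq hM h.2)
        -- The way from `b` over `K'` to `b'` can use the bridge only in its second half, and then
        -- it arrives at `M` from `K`.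
        by_cases h2 : K' = K ∧ hb'.node = hM.node
        · obtain rfl := hb'.eq_of_node_eq hM h2.2
          refine .inr ⟨rfl, ?_⟩
          by_contra hlj
          have h3 : b' j ∈ K'.1 := by
            rw [← hl j (Ne.symm hlj)]
            exact Finset.mem_image_of_mem b (Finset.mem_erase.2 ⟨Ne.symm hlj, Finset.mem_univ _⟩)
          rw [h2.1] at h3
          obtain ⟨i, hi, hij⟩ := Finset.mem_image.1 h3
          exact Finset.ne_of_mem_erase hi (hb'.injective hij)
        · have h3 := hadj K' hb'.node (hb.common_adj_right hb' hbb hl) hKc' hb'.card_node h2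
          exact .inl ⟨hb', hbr'.trans (h1.symm.reachable.trans h3.reachable)⟩
  · refine ⟨∅, Set.notMem_empty _, fun b hb hbM hne => ?_, fun b hb => absurd hb (Set.notMem_empty _)⟩
    exact absurd ⟨b, hb, fun l hl => (hbM l hl).symm, hne.symm⟩ hex

end Rainbow

/-! ### A periodic tour visits every `(k+1)`-clique with every index. -/

section Visit

open Fin.CommRing Fin.NatCast

variable {V : Type*} {k N : ℕ} {G : SimpleGraph V} {C : G.Coloring (Fin (k + 1))}
  {ι : V → Fin (N + 1)}
  {good : (Fin (k + 1) → Fin (N + 1)) → Fin (k + 1) → Bool}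

/-- The states of the tour that occur on proper inputs: up to the entry with the current index, the
tuple is a rainbow tuple. -/
def TourState (C : G.Coloring (Fin (k + 1))) (ι : V → Fin (N + 1))
    (s : (Fin (k + 1) → Fin (N + 1)) × Fin (k + 1)) : Prop :=
  ∃ b, Rainbow C b ∧ ∀ j, j ≠ s.2 → s.1 j = ι (b j)

/-- The test `good` is correct on the states that occur on proper inputs. -/
def GoodSpec (C : G.Coloring (Fin (k + 1))) (ι : V → Fin (N + 1))
    (good : (Fin (k + 1) → Fin (N + 1)) → Fin (k + 1) → Bool) : Prop :=
  ∀ s, TourState C ι s → (good s.1 s.2 = true ↔ ∃ b, Rainbow C b ∧ s.1 = ι ∘ b)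

theorem tourState_of_rainbow {b : Fin (k + 1) → V} (hb : Rainbow C b) (i : Fin (k + 1)) :
    TourState C ι (ι ∘ b, i) := ⟨b, hb, fun _ _ => rfl⟩

/-- A good tuple is itself a clique and becomes the new witness; otherwise the same slot changes
again, and the old witness still serves. -/
theorem TourState.step (hg : GoodSpec C ι good) {s : (Fin (k + 1) → Fin (N + 1)) × Fin (k + 1)}
    (hs : TourState C ι s) : TourState C ι (tourStep good s) := by
  by_cases h : good s.1 s.2 = true
  · obtain ⟨b, hb, hsb⟩ := (hg s hs).1 h
    refine ⟨b, hb, fun j hj => ?_⟩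
    simp only [tourStep, h, if_true] at hj ⊢
    rw [Function.update_of_ne hj, hsb]; rfl
  · obtain ⟨b, hb, hsb⟩ := hs
    refine ⟨b, hb, fun j hj => ?_⟩
    simp only [tourStep, h] at hj ⊢
    rw [Function.update_of_ne hj]
    exact hsb j hj

theorem TourState.iterate (hg : GoodSpec C ι good)
    {s : (Fin (k + 1) → Fin (N + 1)) × Fin (k + 1)} (hs : TourState C ι s) (t : ℕ) :
    TourState C ι ((tourStep good)^[t] s) := by
  induction t with
  | zero => exact hs
  | succ t ih => rw [Function.iterate_succ_apply']; exact ih.step hg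

variable {y : (Fin (k + 1) → Fin (N + 1)) × Fin (k + 1)}

/-- The states that the tour reaches from `y`. -/
def Visits (good : (Fin (k + 1) → Fin (N + 1)) → Fin (k + 1) → Bool)
    (y z : (Fin (k + 1) → Fin (N + 1)) × Fin (k + 1)) : Prop :=
  ∃ t, (tourStep good)^[t] y = z

theorem Visits.step {z : (Fin (k + 1) → Fin (N + 1)) × Fin (k + 1)} (h : Visits good y z) :
    Visits good y (tourStep good z) := by
  obtain ⟨t, rfl⟩ := h
  exact ⟨t + 1, Function.iterate_succ_apply' _ _ _⟩

theorem Visits.tourState (hg : GoodSpec C ι good) (hy : TourState C ι y)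
    {z : (Fin (k + 1) → Fin (N + 1)) × Fin (k + 1)} (h : Visits good y z) : TourState C ι z := by
  obtain ⟨t, rfl⟩ := h
  exact hy.iterate hg t

/-- If a tour of period `τ` enters a `(k + 1)`-clique by one index, then it also does by the next
one, since it has to come back from beyond the `k`-clique through which it leaves. -/
theorem Visits.succ_index (hT : (decompTree k G).IsAcyclic) (hι : Function.Injective ι)
    (hg : GoodSpec C ι good) (hy : TourState C ι y) {τ : ℕ} (hτ : 0 < τ)
    (hper : (tourStep good)^[τ] y = y) {M : Fin (k + 1) → V} (hM : Rainbow C M)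
    {i : Fin (k + 1)} (h : Visits good y (ι ∘ M, i)) : Visits good y (ι ∘ M, i + 1) := by
  by_contra hnot
  obtain ⟨S, hS1, hS2, hS3⟩ := exists_side hT hM (i + 1)
  have hgood : ∀ {b}, Rainbow C b → ∀ l, good (ι ∘ b) l = true := fun hb l =>
    (hg (_, l) (tourState_of_rainbow hb l)).2 ⟨_, hb, rfl⟩
  -- `W` holds while the tour is beyond the `k`-clique through which it left `M`, or is still trying
  -- candidates there. `Z` holds just after a step and also admits the arrival at `(M, i + 1)`,
  -- which `hnot` excludes. So the tour never leaves `W` again.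
  let Z : (Fin (k + 1) → Fin (N + 1)) × Fin (k + 1) → Prop := fun s =>
    ∃ b, Rainbow C b ∧ (∀ l, l ≠ s.2 → s.1 l = ι (b l)) ∧ (b ∈ S ∨ (b = M ∧ s.2 = i + 1))
  let W : (Fin (k + 1) → Fin (N + 1)) × Fin (k + 1) → Prop := fun s =>
    (∃ b, Rainbow C b ∧ b ∈ S ∧ s.1 = ι ∘ b) ∨ (¬ good s.1 s.2 = true ∧ Z s)
  have hstep : ∀ s, (W s ∨ s = (ι ∘ M, i)) → Z (tourStep good s) := by
    rintro ⟨a, l⟩ ((⟨b, hb, hbS, rfl⟩ | ⟨hng, b, hb, hab, hbS⟩) | h)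
    · refine ⟨b, hb, fun l' hl' => ?_, .inl hbS⟩
      simp only [tourStep, hgood hb, if_true] at hl' ⊢
      rw [Function.update_of_ne hl']; rfl
    · refine ⟨b, hb, fun l' hl' => ?_, ?_⟩
      · simp only [tourStep, hng] at hl' ⊢
        rw [Function.update_of_ne hl']
        exact hab l' hl'
      · simpa [tourStep, hng] using hbS
    · obtain ⟨rfl, rfl⟩ := Prod.mk.inj h
      refine ⟨M, hM, fun l' hl' => ?_, .inr ⟨rfl, ?_⟩⟩
      · simp only [tourStep, hgood hM, if_true] at hl' ⊢
        rw [Function.update_of_ne hl']; rfl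
      · simp only [tourStep, hgood hM, if_true]
  have hZW : ∀ s, Visits good y s → Z s → W s := by
    rintro ⟨a, l⟩ hv ⟨b, hb, hab, hbS⟩
    by_cases hga : good a l = true
    · obtain ⟨b', hb', rfl⟩ := (hg _ (hv.tourState hg hy)).1 hga
      have hbb : ∀ l', l' ≠ l → b l' = b' l' := fun l' hl' => (hι (hab l' hl')).symm
      have hS' : b' ∈ S ∨ (b' = M ∧ l = i + 1) := by
        rcases hbS with hbS | ⟨rfl, rfl⟩
        · exact hS3 b hbS hb b' hb' l hbb
        · by_cases hbM : b' = b
          · exact .inr ⟨hbM, rfl⟩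
          · exact .inl (hS2 b' hb' (fun l' hl' => (hbb l' hl').symm) hbM)
      rcases hS' with h1 | ⟨rfl, rfl⟩
      · exact .inl ⟨b', hb', h1, rfl⟩
      · exact absurd hv hnot
    · exact .inr ⟨hga, b, hb, hab, hbS⟩
  have hall : ∀ t, Visits good y ((tourStep good)^[t] (ι ∘ M, i)) ∧
      W ((tourStep good)^[t + 1] (ι ∘ M, i)) := by
    intro t
    induction t with
    | zero => exact ⟨h, hZW _ h.step (hstep _ (.inr rfl))⟩
    | succ t ih =>
      have h1 : Visits good y ((tourStep good)^[t + 1] (ι ∘ M, i)) := by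
        rw [Function.iterate_succ_apply']; exact ih.1.step
      refine ⟨h1, ?_⟩
      rw [Function.iterate_succ_apply']
      exact hZW _ h1.step (hstep _ (.inl ih.2))
  obtain ⟨t, ht⟩ := h
  have hret : (tourStep good)^[τ] (ι ∘ M, i) = (ι ∘ M, i) := by
    rw [← ht, ← Function.iterate_add_apply, add_comm τ t, Function.iterate_add_apply, hper]
  -- Periodicity leads back to `(M, i)`, which is not in `W`: `M` is not in `S`, and its tuple is
  -- good.
  have hW := (hall (τ - 1)).2
  rw [Nat.sub_add_cancel hτ, hret] at hW
  rcases hW with ⟨b, -, hbS, hMb⟩ | ⟨hng, -⟩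
  · obtain rfl : M = b := funext fun l => hι (congrFun hMb l)
    exact hS1 hbS
  · exact hng (hgood hM i)

theorem Visits.index (hT : (decompTree k G).IsAcyclic) (hι : Function.Injective ι)
    (hg : GoodSpec C ι good) (hy : TourState C ι y) {τ : ℕ} (hτ : 0 < τ)
    (hper : (tourStep good)^[τ] y = y) {M : Fin (k + 1) → V} (hM : Rainbow C M)
    {i : Fin (k + 1)} (h : Visits good y (ι ∘ M, i)) (i' : Fin (k + 1)) :
    Visits good y (ι ∘ M, i') := by
  have key : ∀ t : ℕ, Visits good y (ι ∘ M, i + (t : Fin (k + 1))) := by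
    intro t
    induction t with
    | zero => simpa using h
    | succ t ih =>
      rw [Nat.cast_succ, ← add_assoc]
      exact Visits.succ_index hT hι hg hy hτ hper hM ih
  have := key (i' - i).val
  rwa [Fin.cast_val_eq_self, add_sub_cancel] at this

/-- Slot `j` runs through all values. When a clique is met on the way, the tour goes off through
slot `j + 1`; but by `Visits.index` it also visits this clique with index `j - 1`, and from there
slot `j` is advanced further. -/
theorem Visits.update (hT : (decompTree k G).IsAcyclic) (hι : Function.Injective ι)
    (hg : GoodSpec C ι good) (hy : TourState C ι y) {τ : ℕ} (hτ : 0 < τ)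
    (hper : (tourStep good)^[τ] y = y) {B : Fin (k + 1) → V}
    {j : Fin (k + 1)} {z : (Fin (k + 1) → Fin (N + 1)) × Fin (k + 1)} (h : Visits good y z)
    (hj : (if good z.1 z.2 = true then z.2 + 1 else z.2) = j)
    (hz : ∀ l, l ≠ j → z.1 l = ι (B l)) : Visits good y (ι ∘ B, j) := by
  have key : ∀ (d : ℕ) (z : (Fin (k + 1) → Fin (N + 1)) × Fin (k + 1)), Visits good y z →
      (if good z.1 z.2 = true then z.2 + 1 else z.2) = j → (∀ l, l ≠ j → z.1 l = ι (B l)) →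
      z.1 j + ((d + 1 : ℕ) : Fin (N + 1)) = ι (B j) → Visits good y (ι ∘ B, j) := by
    intro d
    induction d with
    | zero =>
      rintro ⟨a, l⟩ hv hj hz hd
      have h1 := hv.step
      simp only [tourStep, hj] at h1
      have h2 : Function.update a j (a j + 1) = ι ∘ B := by
        funext l
        by_cases hl : l = j
        · subst hl; simpa using hd
        · rw [Function.update_of_ne hl]; exact hz l hl
      rwa [h2] at h1
    | succ d ih =>
      rintro ⟨a, l⟩ hv hj hz hd
      have h1 := hv.step
      simp only [tourStep, hj] at h1
      have hz' : ∀ l, l ≠ j → Function.update a j (a j + 1) l = ι (B l) := fun l hl => by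
        rw [Function.update_of_ne hl]; exact hz l hl
      have hd' : Function.update a j (a j + 1) j + ((d + 1 : ℕ) : Fin (N + 1)) = ι (B j) := by
        rw [← hd, Function.update_self]
        push_cast
        ring
      by_cases hgood : good (Function.update a j (a j + 1)) j = true
      · obtain ⟨b, hb, hbeq⟩ := (hg _ (h1.tourState hg hy)).1 hgood
        simp only at hbeq
        rw [hbeq] at h1 hz' hd'
        refine ih (ι ∘ b, j - 1) (Visits.index hT hι hg hy hτ hper hb h1 _) ?_ hz' hd'
        rw [if_pos ((hg _ (tourState_of_rainbow hb _)).2 ⟨b, hb, rfl⟩)]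
        exact sub_add_cancel j 1
      · exact ih _ h1 (if_neg hgood) hz' hd'
  by_cases hd : ι (B j) = z.1 j
  -- The slot already holds the wanted value, and a full round of `N + 1` increments restores it.
  · exact key N z h hj hz (by simp [hd])
  · obtain ⟨d, hd'⟩ := Nat.exists_eq_succ_of_ne_zero (n := (ι (B j) - z.1 j).val) (fun h0 =>
      hd (sub_eq_zero.1 (Fin.ext h0)))
    refine key d z h hj hz ?_
    have h1 : ((d + 1 : ℕ) : Fin (N + 1)) = ι (B j) - z.1 j :=
      (congrArg (fun m : ℕ => (m : Fin (N + 1))) hd').symm.trans (Fin.cast_val_eq_self _)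
    rw [h1]
    exact add_sub_cancel _ _

theorem visits_rainbow_of_periodic (hT : (decompTree k G).IsTree) (hι : Function.Injective ι)
    (hg : GoodSpec C ι good) (hy : TourState C ι y) {τ : ℕ} (hτ : 0 < τ)
    (hper : (tourStep good)^[τ] y = y) {B : Fin (k + 1) → V} (hB : Rainbow C B)
    (i : Fin (k + 1)) : Visits good y (ι ∘ B, i) := by
  have hgood : ∀ {b}, Rainbow C b → ∀ l, good (ι ∘ b) l = true := fun hb l =>
    (hg (_, l) (tourState_of_rainbow hb l)).2 ⟨_, hb, rfl⟩
  have hidx := fun {b : Fin (k + 1) → V} (hb : Rainbow C b) {i : Fin (k + 1)}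
    (h : Visits good y (ι ∘ b, i)) =>
      Visits.index hT.isAcyclic hι hg hy hτ hper hb h
  obtain ⟨A, hA, j, hAj⟩ : ∃ A, Rainbow C A ∧ ∃ j, Visits good y (ι ∘ A, j) := by
    by_cases hyg : good y.1 y.2 = true
    · obtain ⟨b, hb, hyb⟩ := (hg y hy).1 hyg
      exact ⟨b, hb, y.2, 0, Prod.ext hyb rfl⟩
    · obtain ⟨b, hb, hyb⟩ := hy
      -- Only the current slot of `y` is open, so the tour reaches a clique by filling it.
      exact ⟨b, hb, y.2, Visits.update hT.isAcyclic hι hg ⟨b, hb, hyb⟩ hτ hper ⟨0, rfl⟩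
        (if_neg hyg) hyb⟩
  obtain ⟨p⟩ := hT.connected hB.node hA.node
  have key : ∀ M : Node k G, (decompTree k G).Reachable hA.node M →
      ∃ b, ∃ hb : Rainbow C b, M.1 ⊆ hb.node.1 ∧ ∀ i, Visits good y (ι ∘ b, i) := by
    intro M hM
    rw [SimpleGraph.reachable_iff_reflTransGen] at hM
    induction hM with
    | refl => exact ⟨A, hA, subset_rfl, hidx hA hAj⟩
    | @tail M M' _ hMM' ih =>
      obtain ⟨b, hb, hMb, hv⟩ := ih
      rcases M.2.card with hM | hM
      · obtain ⟨hM', hsub⟩ := decompTree_adj_of_card hMM' hM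
        obtain ⟨b', hb', rfl⟩ := exists_rainbow C hM'
        obtain ⟨l, hl⟩ : ∃ l, ∀ l', l' ≠ l → b l' ∈ M.1 := by
          classical
          obtain ⟨v, hv, hvM⟩ : ∃ v ∈ hb.node.1, v ∉ M.1 :=
            Finset.exists_mem_notMem_of_card_lt_card (by rw [hM, hb.card_node]; omega)
          refine ⟨C v, fun l' hl' => ?_⟩
          have h1 : M.1 ⊆ hb.node.1.erase v := fun u hu =>
            Finset.mem_erase.2 ⟨ne_of_mem_of_not_mem hu hvM, hMb hu⟩
          have h2 := Finset.eq_of_subset_of_card_le h1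
            (by rw [Finset.card_erase_of_mem hv, hM, hb.card_node]; omega)
          rw [h2, Finset.mem_erase]
          refine ⟨fun h3 => hl' ?_, hb.mem_node l'⟩
          rw [← h3, hb.color]
        -- Both tuples contain `M`, and the slot of a vertex is its colour; so they differ at most
        -- in the slot that `M` leaves open.
        have hbb : ∀ l', l' ≠ l → b l' = b' l' := fun l' hl' => by
          have := hb'.eq_of_mem_node (hsub (hl l' hl'))
          rw [← this, hb.color]
        refine ⟨b', hb', subset_rfl, hidx hb' (Visits.update hT.isAcyclic hι hg hy hτ hper
          (hv (l - 1)) ?_ fun l' hl' => congrArg ι (hbb l' hl'))⟩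
        · rw [if_pos (hgood hb _)]
          exact sub_add_cancel l 1
      · obtain ⟨-, hsub⟩ := decompTree_adj_of_card_succ hMM' hM
        exact ⟨b, hb, hsub.trans hMb, hv⟩
  obtain ⟨b, hb, hsub, hv⟩ := key hB.node (hT.connected _ _)
  obtain rfl := hB.eq_of_node_eq hb
    (Subtype.ext (Finset.eq_of_subset_of_card_le hsub (by rw [hB.card_node, hb.card_node])))
  exact hv i

end Visit

end KTree

namespace KTree

/-! ### Iterates of a map on a finite set. -/

section Iterate

variable {A : Type*} {f : A → A}

theorem exists_periodic_iterate [Finite A] (f : A → A) (x : A) :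
    ∃ m τ, 0 < τ ∧ f^[τ] (f^[m] x) = f^[m] x := by
  have key : ∀ m m', m < m' → f^[m] x = f^[m'] x → f^[m' - m] (f^[m] x) = f^[m] x := by
    intro m m' h heq
    rw [← Function.iterate_add_apply, Nat.sub_add_cancel h.le, heq]
  obtain ⟨m, m', hne, heq⟩ := Finite.exists_ne_map_eq_of_infinite fun t : ℕ => f^[t] x
  rcases lt_or_gt_of_ne hne with h | h
  · exact ⟨m, m' - m, Nat.sub_pos_of_lt h, key m m' h heq⟩
  · exact ⟨m', m - m', Nat.sub_pos_of_lt h, key m' m h heq.symm⟩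

/-- Up to the first visit no state repeats, since a repetition could be cut out. -/
theorem exists_iterate_lt_card [Fintype A] {x z : A} (h : ∃ t, f^[t] x = z) :
    ∃ t < Fintype.card A, f^[t] x = z := by
  classical
  refine ⟨Nat.find h, ?_, Nat.find_spec h⟩
  have hinj : Set.InjOn (fun t => f^[t] x) (Finset.range (Nat.find h + 1)) := by
    have key : ∀ s s', s < s' → s' ≤ Nat.find h → f^[s] x ≠ f^[s'] x := by
      intro s s' hss hs' heq
      refine Nat.find_min h (m := Nat.find h - s' + s) (by omega) ?_
      rw [Function.iterate_add_apply, heq, ← Function.iterate_add_apply, Nat.sub_add_cancel hs']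
      exact Nat.find_spec h
    intro s hs s' hs' heq
    simp only [Finset.coe_range, Set.mem_Iio] at hs hs'
    rcases lt_trichotomy s s' with hlt | hlt | hlt
    · exact absurd heq (key s s' hlt (by omega))
    · exact hlt
    · exact absurd heq.symm (key s' s hlt (by omega))
  have := Finset.card_le_card (Finset.subset_univ ((Finset.range (Nat.find h + 1)).image
    fun t => f^[t] x))
  rw [Finset.card_image_of_injOn hinj, Finset.card_range, Finset.card_univ] at this
  omega

end Iterate

/-! ### The colour found by the search. -/

section Search

variable {V : Type*} {k N : ℕ} {G : SimpleGraph V} {C : G.Coloring (Fin (k + 1))}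
  {ι : V → Fin (N + 1)}
  {good : (Fin (k + 1) → Fin (N + 1)) → Fin (k + 1) → Bool}
  {s : (Fin (k + 1) → Fin (N + 1)) × Fin (k + 1)}

/-- The visit is found on the periodic part of the orbit; the first visit then comes within as many
steps as there are states. -/
theorem exists_visit_rainbow (hT : (decompTree k G).IsTree) (hι : Function.Injective ι)
    (hg : GoodSpec C ι good) (hs : TourState C ι s) {B : Fin (k + 1) → V} (hB : Rainbow C B)
    (i : Fin (k + 1)) :
    ∃ t < (N + 1) ^ (k + 1) * (k + 1), (tourStep good)^[t] s = (ι ∘ B, i) := by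
  obtain ⟨m, τ, hτ, hper⟩ := exists_periodic_iterate (tourStep good) s
  obtain ⟨t, ht⟩ := visits_rainbow_of_periodic hT hι hg (hs.iterate hg m) hτ hper hB i
  rw [← Function.iterate_add_apply] at ht
  have := exists_iterate_lt_card ⟨t + m, ht⟩
  simpa using this

-- `searchStep` keeps the latest hit, so all hits are required to have the same index.
open scoped Classical in
theorem searchStep_iterate (v : ℕ) (i : Fin (k + 1))
    (h : ∀ t, good ((tourStep good)^[t] s).1 ((tourStep good)^[t] s).2 = true →
      (((tourStep good)^[t] s).1 ((tourStep good)^[t] s).2).val = v →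
      ((tourStep good)^[t] s).2 = i) (T : ℕ) :
    (searchStep good v)^[T] (s, none) = ((tourStep good)^[T] s,
      if ∃ t < T, good ((tourStep good)^[t] s).1 ((tourStep good)^[t] s).2 = true ∧
        (((tourStep good)^[t] s).1 ((tourStep good)^[t] s).2).val = v then some i else none) := by
  induction T with
  | zero => simp
  | succ T ih =>
    rw [Function.iterate_succ_apply', ih, Function.iterate_succ_apply' (tourStep good), searchStep]
    refine Prod.ext rfl ?_
    by_cases hT : good ((tourStep good)^[T] s).1 ((tourStep good)^[T] s).2 = true ∧
        (((tourStep good)^[T] s).1 ((tourStep good)^[T] s).2).val = v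
    · have h1 : ∃ t < T + 1, good ((tourStep good)^[t] s).1 ((tourStep good)^[t] s).2 = true ∧
        (((tourStep good)^[t] s).1 ((tourStep good)^[t] s).2).val = v := ⟨T, T.lt_succ_self, hT⟩
      rw [if_pos h1]
      exact (if_pos hT).trans (congrArg some (h T hT.1 hT.2))
    · simp only [if_neg hT]
      congr 1
      refine propext ⟨fun ⟨t, ht, h2⟩ => ⟨t, by omega, h2⟩, fun ⟨t, ht, h2⟩ => ?_⟩
      rcases Nat.lt_succ_iff_lt_or_eq.1 ht with h3 | rfl
      · exact ⟨t, h3, h2⟩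
      · exact absurd h2 hT

/-- Since `k ≤ N`, the number of states is at most `(N + 1) ^ (k + 2)`. Every hit yields the same
answer, because the slot of a vertex in a rainbow tuple is its colour. -/
theorem search_eq_some (hT : (decompTree k G).IsTree) (hk : k ≤ N) (hι : Function.Injective ι)
    (hg : GoodSpec C ι good) (hs : TourState C ι s) (v : V) {m : ℕ} (hv : (ι v).val = m)
    (hnode : ∃ M : Node k G, M.1.card = k + 1 ∧ v ∈ M.1) :
    ((searchStep good m)^[(N + 1) ^ (k + 2)] (s, none)).2 = some (C v) := by
  classical
  obtain ⟨M, hM, hvM⟩ := hnode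
  obtain ⟨B, hB, rfl⟩ := exists_rainbow C hM
  have hBv := hB.eq_of_mem_node hvM
  obtain ⟨t, ht, hst⟩ := exists_visit_rainbow hT hι hg hs hB (C v)
  rw [searchStep_iterate m (C v)]
  · refine if_pos ⟨t, ?_, ?_, ?_⟩
    · calc t < (N + 1) ^ (k + 1) * (k + 1) := ht
        _ ≤ (N + 1) ^ (k + 1) * (N + 1) := Nat.mul_le_mul_left _ (by omega)
        _ = (N + 1) ^ (k + 2) := (pow_succ _ _).symm
    · rw [hst]
      exact (hg (_, C v) (tourState_of_rainbow hB _)).2 ⟨B, hB, rfl⟩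
    · rw [hst, ← hv]
      simp [hBv]
  · intro t h1 h2
    obtain ⟨b, hb, hbeq⟩ := (hg _ (hs.iterate hg t)).1 h1
    rw [hbeq, ← hv] at h2
    rw [← hι (Fin.ext h2), hb.color]

theorem search_eq_none (hg : GoodSpec C ι good) (hs : TourState C ι s) {m : ℕ}
    (hm : ∀ v, (ι v).val ≠ m) (T : ℕ) : ((searchStep good m)^[T] (s, none)).2 = none := by
  classical
  have h0 : ∀ t, good ((tourStep good)^[t] s).1 ((tourStep good)^[t] s).2 = true →
      (((tourStep good)^[t] s).1 ((tourStep good)^[t] s).2).val ≠ m := by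
    intro t h1
    obtain ⟨b, hb, hbeq⟩ := (hg _ (hs.iterate hg t)).1 h1
    rw [hbeq]
    exact hm _
  rw [searchStep_iterate m 0 fun t h1 h2 => absurd h2 (h0 t h1)]
  exact if_neg fun ⟨t, _, h1, h2⟩ => h0 t h1 h2

end Search

/-! ### Decoding the input -/

section Decode

theorem getElem?_flatMap_of_length {A B : Type*} {f : A → List B} {m : ℕ}
    (hf : ∀ a, (f a).length = m) (l : List A) (i : ℕ) {j : ℕ} (hj : j < m) :
    (l.flatMap f)[i * m + j]? = (l[i]?).bind fun a => (f a)[j]? := by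
  induction l generalizing i with
  | nil => simp
  | cons a l ih =>
    rw [List.flatMap_cons]
    rcases i with _ | i
    · rw [List.getElem?_append_left (by rw [hf]; omega)]
      simp
    · rw [List.getElem?_append_right (by rw [hf, Nat.succ_mul]; omega), hf]
      have : (i + 1) * m + j - m = i * m + j := by rw [Nat.succ_mul]; omega
      rw [this, ih]
      simp

theorem countBefore_inl_append {A B : Type} {ends : A ⊕ B → Bool}
    (hends : ∀ a, ends (.inl a) = false) (u : List A) (l : List (A ⊕ B)) :
    countBefore ends Sum.isRight (u.map Sum.inl ++ l) = countBefore ends Sum.isRight l := by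
  induction u with
  | nil => rfl
  | cons a u ih => simpa [countBefore, hends] using ih

/-- Each row has a single right symbol, so counting these symbols numbers the rows. -/
theorem countBefore_rows {A B : Type} {E : Type*} {ends : A ⊕ B → Bool}
    (hends : ∀ a, ends (.inl a) = false) (c : E → B) (row : E → List A) (l : List E) :
    countBefore ends Sum.isRight (l.flatMap fun v => .inr (c v) :: (row v).map Sum.inl) =
      l.findIdx fun v => ends (.inr (c v)) := by
  induction l with
  | nil => rfl
  | cons v l ih =>
    rw [List.flatMap_cons, List.cons_append, countBefore, List.findIdx_cons]
    cases h : ends (.inr (c v))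
    · simp [countBefore_inl_append hends, ih, add_comm]
    · simp

theorem findIdx_finRange {n : ℕ} {p : Fin n → Bool} {v : Fin n} (hp : ∀ w, p w = true ↔ w = v) :
    (List.finRange n).findIdx p = v := by
  rw [List.findIdx_eq (by simp)]
  simp only [List.getElem_finRange]
  refine ⟨(hp _).2 (by simp), fun j hj => ?_⟩
  rw [Bool.eq_false_iff]
  intro h
  have := congrArg Fin.val ((hp _).1 h)
  simp at this
  omega

theorem findIdx_finRange_of_forall {n : ℕ} {p : Fin n → Bool} (hp : ∀ w, p w = false) :
    (List.finRange n).findIdx p = n := by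
  have := List.findIdx_eq_length.2 (fun w (_ : w ∈ List.finRange n) => hp w)
  simpa using this

variable {k n : ℕ} {G : SimpleGraph (Fin n)} [DecidableRel G.Adj] {R : Finset (Fin n)}
  {col : {v // v ∈ R} → Fin (k + 1)}

theorem encodeInput_eq_flatMap (G : SimpleGraph (Fin n)) [DecidableRel G.Adj]
    (R : Finset (Fin n)) (col : {v // v ∈ R} → Fin (k + 1)) : encodeInput G R col =
    (List.finRange n).flatMap fun v =>
      .inr (if h : v ∈ R then some (col ⟨v, h⟩) else none) ::
        ((List.finRange n).map fun w => decide (G.Adj v w)).map Sum.inl := by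
  simp only [encodeInput, List.map_map, Function.comp_def]

theorem vertexCount_encodeInput : vertexCount (encodeInput G R col) = n := by
  rw [vertexCount, encodeInput_eq_flatMap, countBefore_rows fun _ => rfl]
  exact findIdx_finRange_of_forall fun _ => rfl

theorem startTuple_encodeInput (i : Fin (k + 1)) {v : Fin n} (hv : v ∈ R) (hvi : col ⟨v, hv⟩ = i)
    (huniq : ∀ w : {v // v ∈ R}, col w = i → w.1 = v) :
    (startTuple (encodeInput G R col) i).val = v := by
  rw [startTuple, encodeInput_eq_flatMap, Fin.val_mk, countBefore_rows fun _ => by simp]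
  refine findIdx_finRange fun w => ?_
  rw [decide_eq_true_eq, Sum.inr.injEq]
  constructor
  · intro h
    split_ifs at h with hw
    exact huniq ⟨w, hw⟩ (Option.some.inj h)
  · rintro rfl
    rw [dif_pos hv, hvi]

theorem startTuple_encodeInput_of_forall (i : Fin (k + 1)) (h : ∀ w : {v // v ∈ R}, col w ≠ i) :
    (startTuple (encodeInput G R col) i).val = n := by
  rw [startTuple, encodeInput_eq_flatMap, Fin.val_mk, countBefore_rows fun _ => by simp]
  refine findIdx_finRange_of_forall fun w => ?_
  rw [decide_eq_false_iff_not, Sum.inr.injEq]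
  intro hw
  split_ifs at hw with hwR
  exact h ⟨w, hwR⟩ (Option.some.inj hw)

theorem adjAt_encodeInput (v w : Fin n) :
    adjAt (encodeInput G R col) n v w = decide (G.Adj v w) := by
  have h : (encodeInput G R col)[v * (n + 1) + (w + 1)]? = some (.inl (decide (G.Adj v w))) := by
    rw [encodeInput, getElem?_flatMap_of_length (by simp) _ _ (by omega)]
    simp
  have hlt : v * (n + 1) + (w + 1) < (encodeInput G R col).length :=
    (List.getElem?_eq_some_iff.1 h).1
  rw [adjAt, min_eq_left (by omega), readInput, if_neg (by omega)]
  have h2 : v * (n + 1) + w.val + 2 - 1 = v * (n + 1) + (w + 1) := by omega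
  rw [h2, h]
  rfl

/-- The numbering of the vertices used by the machine. -/
def vertexIndex (G : SimpleGraph (Fin n)) [DecidableRel G.Adj]
    (R : Finset (Fin n)) (col : {v // v ∈ R} → Fin (k + 1)) (v : Fin n) :
    Fin (vertexCount (encodeInput G R col) + 1) :=
  ⟨v, by rw [vertexCount_encodeInput]; omega⟩

theorem vertexIndex_injective : Function.Injective (vertexIndex G R col) := fun u v h => by
  have := congrArg Fin.val h
  exact Fin.ext this

theorem goodSpec_encodeInput (C : G.Coloring (Fin (k + 1))) :
    GoodSpec C (vertexIndex G R col) (goodAt (encodeInput G R col)) := by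
  rintro ⟨a, i⟩ ⟨b, hb, hab⟩
  have hgood : goodAt (encodeInput G R col) a i = true ↔ (a i).val ≠ n ∧
      ∀ j, j ≠ i → adjAt (encodeInput G R col) n (a i) (a j) = true := by
    simp only [goodAt, vertexCount_encodeInput]
    simp [or_iff_not_imp_left]
  rw [hgood]
  constructor
  · rintro ⟨hn, hadj⟩
    have hlt : (a i).val < n := by
      have h1 := (a i).2
      have h2 : vertexCount (encodeInput G R col) = n := vertexCount_encodeInput
      omega
    have hadj' : ∀ j, j ≠ i → G.Adj ⟨(a i).val, hlt⟩ (b j) := by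
      intro j hj
      have h1 := hadj j hj
      have h2 : a j = vertexIndex G R col (b j) := hab j hj
      rw [h2] at h1
      have h3 := adjAt_encodeInput (G := G) (R := R) (col := col) ⟨(a i).val, hlt⟩ (b j)
      exact of_decide_eq_true (h3.symm.trans h1)
    refine ⟨Function.update b i ⟨(a i).val, hlt⟩, ⟨fun j => ?_, fun j j' hjj => ?_⟩, ?_⟩
    · by_cases hj : j = i
      · subst hj
        rw [Function.update_self]
        -- If the new vertex had another colour, it would clash with its neighbour in the slot of
        -- that colour.
        by_contra hne
        refine C.valid (hadj' _ hne) ?_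
        rw [hb.color]
      · rw [Function.update_of_ne hj, hb.color]
    · by_cases hj : j = i
      · subst hj
        rw [Function.update_self, Function.update_of_ne (Ne.symm hjj)]
        exact hadj' j' (Ne.symm hjj)
      · by_cases hj' : j' = i
        · subst hj'
          rw [Function.update_self, Function.update_of_ne hj]
          exact (hadj' j hj).symm
        · rw [Function.update_of_ne hj, Function.update_of_ne hj']
          exact hb.adj j j' hjj
    · funext j
      by_cases hj : j = i
      · subst hj
        rw [Function.comp_apply, Function.update_self]
        rfl
      · rw [Function.comp_apply, Function.update_of_ne hj]
        exact hab j hj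
  · rintro ⟨b', hb', rfl⟩
    refine ⟨(b' i).2.ne, fun j hj => ?_⟩
    exact (adjAt_encodeInput (b' i) (b' j)).trans (decide_eq_true (hb'.adj i j hj.symm))

theorem tourState_start {R : Node k G} (C : G.Coloring (Fin (k + 1)))
    {col : {v // v ∈ R.1} → Fin (k + 1)} (hC : ∀ v : {v // v ∈ R.1}, C v.1 = col v) :
    TourState C (vertexIndex G R.1 col)
      (startTuple (encodeInput G R.1 col), startIndex (encodeInput G R.1 col)) := by
  obtain ⟨b, hb, hsub⟩ : ∃ b, ∃ hb : Rainbow C b, R.1 ⊆ hb.node.1 := by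
    rcases R.2.card with hR | hR
    · obtain ⟨A, -, -, hA, -⟩ := Node.exists_ne_of_card hR
      obtain ⟨h1, h2⟩ := decompTree_adj_of_card hA hR
      obtain ⟨b, hb, rfl⟩ := exists_rainbow C h1
      exact ⟨b, hb, h2⟩
    · obtain ⟨b, hb, rfl⟩ := exists_rainbow C hR
      exact ⟨b, hb, subset_rfl⟩
  have hcol : ∀ (w : {v // v ∈ R.1}) (i : Fin (k + 1)), col w = i → w.1 = b i := by
    rintro w i rfl
    rw [← hC]
    exact (hb.eq_of_mem_node (hsub w.2)).symm
  have hmem : ∀ i, b i ∈ R.1 → (startTuple (encodeInput G R.1 col) i).val = b i := fun i hi =>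
    startTuple_encodeInput i hi ((hC ⟨b i, hi⟩).symm.trans (hb.color i)) fun w hw => hcol w i hw
  have hnmem : ∀ i, b i ∉ R.1 → (startTuple (encodeInput G R.1 col) i).val = n := fun i hi =>
    startTuple_encodeInput_of_forall i fun w hw => hi (hcol w i hw ▸ w.2)
  refine ⟨b, hb, fun j hj => Fin.ext ?_⟩
  refine hmem j ?_
  by_contra hjR
  -- `R` omits at most one vertex of the tuple, so the first missing colour is the only one. If none
  -- is missing, any index would do, and `startIndex` defaults to `0`.
  have hcard : ∀ i, b i ∉ R.1 → i = j := by
    intro i hi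
    by_contra hij
    have h1 : R.1 ⊆ (hb.node.1.erase (b i)).erase (b j) := fun u hu =>
      Finset.mem_erase.2 ⟨ne_of_mem_of_not_mem hu hjR,
        Finset.mem_erase.2 ⟨ne_of_mem_of_not_mem hu hi, hsub hu⟩⟩
    have h2 := Finset.card_le_card h1
    rw [Finset.card_erase_of_mem (Finset.mem_erase.2
      ⟨fun h => hij (hb.injective h.symm), hb.mem_node j⟩),
      Finset.card_erase_of_mem (hb.mem_node i), hb.card_node] at h2
    have h3 := R.2.card
    have h4 := Fin.val_ne_of_ne hij
    have h5 := i.2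
    have h6 := j.2
    omega
  have hfind : ∃ i, (List.finRange (k + 1)).find? (fun i =>
      decide ((startTuple (encodeInput G R.1 col) i).val =
        vertexCount (encodeInput G R.1 col))) = some i := by
    rw [← Option.isSome_iff_exists, List.find?_isSome]
    exact ⟨j, List.mem_finRange j, by simp [hnmem j hjR, vertexCount_encodeInput]⟩
  obtain ⟨i, hi⟩ := hfind
  have hi' := List.find?_some hi
  replace hi' := (of_decide_eq_true hi').trans vertexCount_encodeInput
  have hiR : b i ∉ R.1 := fun h => (b i).2.ne ((hmem i h).symm.trans hi')
  refine hj ?_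
  rw [← hcard i hiR]
  simp only [startIndex, hi, Option.getD_some]

theorem colorWord_encodeInput (hG : IsKTree k G) (R : Node k G)
    (col : (cliqueGraph G R).Coloring (Fin (k + 1))) {c : Fin n → Fin (k + 1)}
    (hc : IsProcedureColouring R col c) :
    colorWord (encodeInput G R.1 col) = List.ofFn c := by
  have hk := hG.lt_card_of_node R
  obtain ⟨C, -, huniq, hC, -⟩ := hG.exists_procedure_coloring R col
  obtain rfl := huniq c hc
  have hT := hG.isTree hk
  have hcount : vertexCount (encodeInput G R.1 col) = n := vertexCount_encodeInput
  have hsome : ∀ v : Fin n, searchColor (encodeInput G R.1 col) v = some (C v) := fun v =>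
    search_eq_some hT (by rw [Fintype.card_fin] at hk; omega) vertexIndex_injective
      (goodSpec_encodeInput C) (tourState_start C hC) v rfl (hG.exists_mem_node hk v)
  -- The loop of the program includes the value `n`, which is not a vertex and produces no output.
  have hnone : searchColor (encodeInput G R.1 col) n = none :=
    search_eq_none (goodSpec_encodeInput C) (tourState_start C hC) (fun v => v.2.ne) _
  rw [colorWord, hcount, List.range_succ, List.flatMap_append]
  simp only [List.flatMap_singleton, hnone, Option.toList_none, List.append_nil]
  rw [← List.map_coe_finRange_eq_range, List.flatMap_map, List.ofFn_eq_map]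
  simp only [hsome, Option.toList_some]
  exact List.map_eq_flatMap.symm

end Decode

end KTree

theorem mainTheorem9 (k : ℕ) :
    -- the decomposition tree is a tree with a unique centre `R`, and from every proper colouring
    -- of `R` the procedure defines a proper colouring of `G`, the only one that extends it
    (∀ (V : Type*) [Fintype V] (G : SimpleGraph V), KTree.IsKTree k G → k < Fintype.card V →
      (KTree.decompTree k G).IsTree ∧
      ∃ R : KTree.Node k G, (KTree.decompTree k G).center = {R} ∧
        ∀ col : (KTree.cliqueGraph G R).Coloring (Fin (k + 1)),
          ∃ C : G.Coloring (Fin (k + 1)),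
            KTree.IsProcedureColouring R col C ∧
            (∀ c : V → Fin (k + 1), KTree.IsProcedureColouring R col c → c = C) ∧
            (∀ v : {v // v ∈ R.1}, C v.1 = col v) ∧
            (∀ C' : G.Coloring (Fin (k + 1)),
              (∀ v : {v // v ∈ R.1}, C' v.1 = col v) → C' = C)) ∧
    -- isomorphisms map centre to centre, and those that preserve the colours of the vertices in
    -- the centre preserve the colours of all vertices
    (∀ (V W : Type*) [Fintype V] [Fintype W] (G : SimpleGraph V) (H : SimpleGraph W),
      KTree.IsKTree k G → KTree.IsKTree k H →
      ∀ (φ : G ≃g H) (R : KTree.Node k G) (R' : KTree.Node k H),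
        R ∈ (KTree.decompTree k G).center → R' ∈ (KTree.decompTree k H).center →
        R.1.map φ.toEquiv.toEmbedding = R'.1 ∧
        ∀ (col : (KTree.cliqueGraph G R).Coloring (Fin (k + 1)))
          (col' : (KTree.cliqueGraph H R').Coloring (Fin (k + 1))),
          (∀ (v : {v // v ∈ R.1}) (w : {w // w ∈ R'.1}), φ v.1 = w.1 → col' w = col v) →
          ∀ (c : V → Fin (k + 1)) (c' : W → Fin (k + 1)),
            KTree.IsProcedureColouring R col c → KTree.IsProcedureColouring R' col' c' →
            ∀ v : V, c' (φ v) = c v) ∧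
    -- for fixed `k`, the colouring is computable in logarithmic space from `G` and the colouring
    -- of `R`
    (∃ f : List (Bool ⊕ Option (Fin (k + 1))) → List (Fin (k + 1)),
      KTree.LogspaceComputable f ∧
      ∀ (n : ℕ) (G : SimpleGraph (Fin n)) [DecidableRel G.Adj], KTree.IsKTree k G →
        ∀ R : KTree.Node k G, R ∈ (KTree.decompTree k G).center →
          ∀ (col : (KTree.cliqueGraph G R).Coloring (Fin (k + 1))) (c : Fin n → Fin (k + 1)),
            KTree.IsProcedureColouring R col c →
            f (KTree.encodeInput G R.1 col) = List.ofFn c) := by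
  refine ⟨fun V _ G hG hk => ⟨hG.isTree hk, ?_⟩,
    fun V W _ _ G H hG hH φ R R' hR hR' => hG.iso_invariant hH φ R R' hR hR',
    KTree.colorWord, KTree.logspaceComputable_colorWord,
    fun n G _ hG R _ col c hc => KTree.colorWord_encodeInput hG R col hc⟩
  obtain ⟨R, hR⟩ := hG.exists_center_eq_singleton hk
  exact ⟨R, hR, fun col => hG.exists_procedure_coloring R col⟩
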